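/- Let $k$ be an algebraically closed field, complete with respect to a non-archimedean absolute value $|\cdot|$, whose residue field has characteristic zero, and let $q\ge 1$ be an integer. Let $\mathcal A$ be a $k$-analytic (Berkovich) annulus, closed, open or semi-open: for an interval $I\subset(0,\infty)$ of the form $[r,R]$, $(r,R)$, $[r,R)$ or $(r,R]$ with $0\le r<R<\infty$ (the case $r=0$, where $I=(0,R)$ or $(0,R]$, being that of a punctured disc), $\mathcal A=\mathcal A_I$ is the space $\{x : |s|_x\in I\}$, with ring of functions $$\mathcal O(\mathcal A_I)=\Big\{\sum_{i\in\mathbb Z}a_is^i : a_i\in k,\ |a_i|\rho^i\to 0 \text{ as } |i|\to\infty \text{ for every } \rho\in I\Big\}.$$ A coordinate on $\mathcal A$ is an analytic function on $\mathcal A$ that induces an isomorphism of $\mathcal A$ onto an annulus $\mathcal A_J$ with $J$ an interval of the same kind. Let $\xi$ be a $q$-differential on $\mathcal A$, that is, a section of $(\Omega^1_{\mathcal A})^{\otimes q}$, that has neither zeros nor poles on $\mathcal A$. Then there is a coordinate $t$ on $\mathcal A$ for which at least one of the following holds: 1. there are an integer $n\neq 0$ divisible by $q$ and $c_n,c_0\in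 k$ such that $$\xi=\big(c_nt^{n/q}+c_0\big)^q\Big(\frac{dt}{t}\Big)^q \quad\text{and}\quad |c_nt^{n/q}|_x>|c_0|_x \text{ for all } x\in\mathcal A;$$ 2. there are an integer $n$ and $c_n\in k$ such that $$\xi=c_n^q\,t^n\Big(\frac{dt}{t}\Big)^q.$$ -/

import Mathlib

open Filter Topology

set_option linter.unusedSectionVars false

noncomputable section

/-- The set of radii of an annulus: a closed, open or semi-open interval of positive reals with
end points `r < R`. For `r = 0` positivity leaves the intervals `(0, R)` and
`(0, R]`, which give the punctured discs. -/
structure RadiusInterval where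
  carrier : Set ℝ
  pos : ∀ ρ ∈ carrier, 0 < ρ
  shape : ∃ r R : ℝ, 0 ≤ r ∧ r < R ∧
    (carrier = Set.Icc r R ∨ carrier = Set.Ioo r R ∨ carrier = Set.Ico r R ∨ carrier = Set.Ioc r R)

namespace RadiusInterval

instance : Membership ℝ RadiusInterval := ⟨fun I ρ => ρ ∈ I.carrier⟩

theorem exists_mem (I : RadiusInterval) : ∃ ρ : ℝ, ρ ∈ I := by
  obtain ⟨r, R, _, h, h' | h' | h' | h'⟩ := I.shape
  · exact ⟨r, show r ∈ I.carrier by rw [h']; exact ⟨le_rfl, h.le⟩⟩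
  · obtain ⟨m, hm⟩ := exists_between h
    exact ⟨m, show m ∈ I.carrier by rw [h']; exact hm⟩
  · exact ⟨r, show r ∈ I.carrier by rw [h']; exact ⟨le_rfl, h⟩⟩
  · exact ⟨R, show R ∈ I.carrier by rw [h']; exact ⟨h, le_rfl⟩⟩

end RadiusInterval

/-- Two-sided sequences `a` such that the Laurent series `∑ aᵢ Tⁱ` converges at every radius
in `I`. -/
def convergentLaurent (k : Type*) [NormedField k] (I : RadiusInterval) : Submodule k (ℤ → k) where
  carrier := {a | ∀ ρ ∈ I, Tendsto (fun i : ℤ => ‖a i‖ * ρ ^ i) cofinite (𝓝 0)}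
  zero_mem' := by
    intro ρ _
    simp
  add_mem' := by
    intro a b ha hb ρ hρ
    have h := (ha ρ hρ).add (hb ρ hρ)
    rw [add_zero] at h
    refine squeeze_zero (fun i => ?_) (fun i => ?_) h
    · exact mul_nonneg (norm_nonneg _) (zpow_nonneg (I.pos ρ hρ).le _)
    · rw [← add_mul]
      exact mul_le_mul_of_nonneg_right (norm_add_le _ _) (zpow_nonneg (I.pos ρ hρ).le _)
  smul_mem' := by
    intro c a ha ρ hρ
    have h := (ha ρ hρ).const_mul ‖c‖
    rw [mul_zero] at h
    refine h.congr (fun i => ?_)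
    simp [mul_assoc]

/-- The ring `𝒪(𝒜_I)` of analytic functions on the annulus `𝒜_I = {|T| ∈ I}`: the Laurent series
`∑ aᵢ Tⁱ` over `k` converging on `I`, with the Cauchy product. -/
def AnalyticFunction (k : Type*) [NormedField k] (I : RadiusInterval) : Type _ :=
  convergentLaurent k I

namespace AnalyticFunction

variable {k : Type*} [NormedField k] {I : RadiusInterval}

instance : AddCommGroup (AnalyticFunction k I) := inferInstanceAs (AddCommGroup (convergentLaurent k I))

instance : Module k (AnalyticFunction k I) := inferInstanceAs (Module k (convergentLaurent k I))

/-- The `i`-th Laurent coefficient. -/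
def coeff (f : AnalyticFunction k I) (i : ℤ) : k := f.1 i

theorem tendsto_coeff (f : AnalyticFunction k I) {ρ : ℝ} (hρ : ρ ∈ I) :
    Tendsto (fun i : ℤ => ‖f.coeff i‖ * ρ ^ i) cofinite (𝓝 0) := f.2 ρ hρ

@[ext]
theorem ext {f g : AnalyticFunction k I} (h : ∀ i, f.coeff i = g.coeff i) : f = g :=
  Subtype.ext (funext h)

@[simp]
theorem coeff_zero (i : ℤ) : (0 : AnalyticFunction k I).coeff i = 0 := rfl

@[simp]
theorem coeff_add (f g : AnalyticFunction k I) (i : ℤ) :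
    (f + g).coeff i = f.coeff i + g.coeff i := rfl

@[simp]
theorem coeff_smul (c : k) (f : AnalyticFunction k I) (i : ℤ) :
    (c • f).coeff i = c * f.coeff i := rfl

/-- The monomial `c Tⁿ`. -/
def monomial (n : ℤ) (c : k) : AnalyticFunction k I :=
  ⟨Pi.single n c, fun ρ _ => by
    refine tendsto_const_nhds.congr' ?_
    have h : ∀ᶠ i : ℤ in cofinite, i ≠ n := by
      simpa using (Set.finite_singleton n).compl_mem_cofinite
    filter_upwards [h] with i hi
    simp [Pi.single_eq_of_ne hi]⟩

theorem coeff_monomial (n : ℤ) (c : k) (i : ℤ) :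
    (monomial n c : AnalyticFunction k I).coeff i = if i = n then c else 0 := by
  simp [monomial, coeff, Pi.single_apply]

/-- The Gauss norm `|f|_ρ = maxᵢ |aᵢ| ρⁱ`. -/
def gaussNorm (ρ : ℝ) (f : AnalyticFunction k I) : ℝ := ⨆ i : ℤ, ‖f.coeff i‖ * ρ ^ i

variable [IsUltrametricDist k]

theorem tendsto_mul_coeff (f g : AnalyticFunction k I) {ρ : ℝ} (hρ : ρ ∈ I) :
    Tendsto (fun p : ℤ × ℤ => ‖f.coeff p.1 * g.coeff p.2‖ * ρ ^ (p.1 + p.2)) cofinite (𝓝 0) := by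
  refine (tendsto_mul_cofinite_nhds_zero (f.tendsto_coeff hρ) (g.tendsto_coeff hρ)).congr ?_
  intro p
  rw [norm_mul, zpow_add₀ (I.pos ρ hρ).ne']
  ring

theorem tendsto_of_mul_zpow {α : Type*} {F : α → k} {ρ : ℝ} (hρ : 0 < ρ) (n : ℤ)
    (h : Tendsto (fun i => ‖F i‖ * ρ ^ n) cofinite (𝓝 0)) : Tendsto F cofinite (𝓝 0) := by
  rw [tendsto_zero_iff_norm_tendsto_zero]
  have h' := h.mul_const (ρ ^ n)⁻¹
  rw [zero_mul] at h'
  refine h'.congr (fun i => ?_)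
  rw [mul_assoc, mul_inv_cancel₀ (zpow_pos hρ n).ne', mul_one]

theorem antidiagonal_injective (n : ℤ) : Function.Injective (fun i : ℤ => (i, n - i)) :=
  fun _ _ h => (Prod.mk.inj h).1

variable [CompleteSpace k]

theorem summable_mul (f g : AnalyticFunction k I) (n : ℤ) :
    Summable (fun i : ℤ => f.coeff i * g.coeff (n - i)) := by
  obtain ⟨ρ, hρ⟩ := I.exists_mem
  refine NonarchimedeanAddGroup.summable_of_tendsto_cofinite_zero
    (tendsto_of_mul_zpow (I.pos ρ hρ) n ?_)
  refine ((f.tendsto_mul_coeff g hρ).comp (antidiagonal_injective n).tendsto_cofinite).congr ?_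
  intro i
  simp

theorem norm_tsum_le_of_forall_le {α : Type*} {F : α → k} {C : ℝ} (hC : 0 ≤ C)
    (h : ∀ i, ‖F i‖ ≤ C) : ‖∑' i, F i‖ ≤ C := by
  by_cases hF : Summable F
  · refine le_of_tendsto hF.hasSum.norm (Eventually.of_forall fun s => ?_)
    exact IsUltrametricDist.norm_sum_le_of_forall_le_of_nonneg hC (fun i _ => h i)
  · simpa [tsum_eq_zero_of_not_summable hF] using hC

/-- The Cauchy product. -/
instance : Mul (AnalyticFunction k I) where
  mul f g := ⟨fun n => ∑' i : ℤ, f.coeff i * g.coeff (n - i), by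
    intro ρ hρ
    have hpos := I.pos ρ hρ
    rw [Metric.tendsto_nhds]
    intro ε hε
    have h := (Metric.tendsto_nhds.1 (f.tendsto_mul_coeff g hρ)) (ε / 2) (half_pos hε)
    rw [eventually_cofinite] at h ⊢
    refine (h.image (fun p : ℤ × ℤ => p.1 + p.2)).subset ?_
    intro n hn
    by_contra hcon
    apply hn
    have key : ∀ i : ℤ, ‖f.coeff i * g.coeff (n - i)‖ ≤ ε / 2 / ρ ^ n := by
      intro i
      by_contra hi
      apply hcon
      refine ⟨(i, n - i), ?_, by simp⟩
      intro hlt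
      apply hi
      rw [le_div_iff₀ (zpow_pos hpos n)]
      rw [dist_zero_right, Real.norm_of_nonneg
        (mul_nonneg (norm_nonneg _) (zpow_nonneg hpos.le _))] at hlt
      simpa using hlt.le
    have h2 := norm_tsum_le_of_forall_le (div_nonneg (half_pos hε).le (zpow_pos hpos n).le) key
    rw [le_div_iff₀ (zpow_pos hpos n)] at h2
    rw [dist_zero_right, Real.norm_of_nonneg
      (mul_nonneg (norm_nonneg _) (zpow_nonneg hpos.le _))]
    exact h2.trans_lt (half_lt_self hε)⟩

theorem coeff_mul (f g : AnalyticFunction k I) (n : ℤ) :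
    (f * g).coeff n = ∑' i : ℤ, f.coeff i * g.coeff (n - i) := rfl

instance : One (AnalyticFunction k I) := ⟨monomial 0 1⟩

theorem one_def : (1 : AnalyticFunction k I) = monomial 0 1 := rfl

theorem coeff_monomial_mul (m : ℤ) (c : k) (f : AnalyticFunction k I) (n : ℤ) :
    (monomial m c * f).coeff n = c * f.coeff (n - m) := by
  rw [coeff_mul, tsum_eq_single m]
  · simp [coeff_monomial]
  · intro i hi
    simp [coeff_monomial, hi]

theorem mul_comm_aux (f g : AnalyticFunction k I) : f * g = g * f := by
  ext n
  rw [coeff_mul, coeff_mul, ← (Equiv.subLeft n).tsum_eq]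
  refine tsum_congr (fun i => ?_)
  simp [mul_comm]

theorem mul_assoc_aux (f g h : AnalyticFunction k I) : f * g * h = f * (g * h) := by
  ext n
  obtain ⟨ρ, hρ⟩ := I.exists_mem
  have hpos := I.pos ρ hρ
  have hsum : Summable (fun p : ℤ × ℤ =>
      f.coeff p.1 * g.coeff (p.2 - p.1) * h.coeff (n - p.2)) := by
    refine NonarchimedeanAddGroup.summable_of_tendsto_cofinite_zero
      (tendsto_of_mul_zpow hpos n ?_)
    obtain ⟨C, hC⟩ := (h.tendsto_coeff hρ).bddAbove_range_of_cofinite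
    have hinj : Function.Injective (fun p : ℤ × ℤ => (p.1, p.2 - p.1)) := by
      rintro ⟨a, b⟩ ⟨c, d⟩ hh
      simp only [Prod.mk.injEq] at hh ⊢
      omega
    have h1 := ((f.tendsto_mul_coeff g hρ).comp hinj.tendsto_cofinite).mul_const C
    rw [zero_mul] at h1
    refine squeeze_zero (fun p => mul_nonneg (norm_nonneg _) (zpow_nonneg hpos.le _)) ?_ h1
    intro p
    have h2 : ‖h.coeff (n - p.2)‖ * ρ ^ (n - p.2) ≤ C := hC ⟨n - p.2, rfl⟩
    have h3 : ρ ^ n = ρ ^ p.2 * ρ ^ (n - p.2) := by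
      rw [← zpow_add₀ hpos.ne']
      congr 1
      ring
    have h4 : p.1 + (p.2 - p.1) = p.2 := by ring
    simp only [Function.comp_apply, h4]
    rw [norm_mul, h3]
    calc ‖f.coeff p.1 * g.coeff (p.2 - p.1)‖ * ‖h.coeff (n - p.2)‖ * (ρ ^ p.2 * ρ ^ (n - p.2))
        = ‖f.coeff p.1 * g.coeff (p.2 - p.1)‖ * ρ ^ p.2 *
          (‖h.coeff (n - p.2)‖ * ρ ^ (n - p.2)) := by ring
      _ ≤ _ := mul_le_mul_of_nonneg_left h2
          (mul_nonneg (norm_nonneg _) (zpow_nonneg hpos.le _))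
  have hl : (f * g * h).coeff n =
      ∑' j : ℤ, ∑' i : ℤ, f.coeff i * g.coeff (j - i) * h.coeff (n - j) := by
    rw [coeff_mul]
    refine tsum_congr (fun j => ?_)
    rw [coeff_mul, tsum_mul_right]
  have hr : (f * (g * h)).coeff n =
      ∑' i : ℤ, ∑' j : ℤ, f.coeff i * g.coeff (j - i) * h.coeff (n - j) := by
    rw [coeff_mul]
    refine tsum_congr (fun i => ?_)
    rw [coeff_mul, ← tsum_mul_left, ← (Equiv.subRight i).tsum_eq]
    refine tsum_congr (fun j => ?_)
    rw [← mul_assoc]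
    congr 2
    simp
  rw [hl, hr]
  exact (Summable.tsum_comm (f := fun i j : ℤ =>
    f.coeff i * g.coeff (j - i) * h.coeff (n - j)) hsum)

theorem one_mul_aux (f : AnalyticFunction k I) : 1 * f = f := by
  ext n
  simp [one_def, coeff_monomial_mul]

theorem add_mul_aux (f g h : AnalyticFunction k I) : (f + g) * h = f * h + g * h := by
  ext n
  rw [coeff_add, coeff_mul, coeff_mul, coeff_mul,
    ← (summable_mul f h n).tsum_add (summable_mul g h n)]
  refine tsum_congr (fun i => ?_)
  rw [coeff_add, add_mul]

theorem zero_mul_aux (f : AnalyticFunction k I) : 0 * f = 0 := by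
  ext n
  simp [coeff_mul]

instance : CommRing (AnalyticFunction k I) where
  mul_assoc := mul_assoc_aux
  one_mul := one_mul_aux
  mul_one f := by rw [mul_comm_aux, one_mul_aux]
  left_distrib f g h := by
    rw [mul_comm_aux, add_mul_aux, mul_comm_aux g, mul_comm_aux h]
  right_distrib := add_mul_aux
  zero_mul := zero_mul_aux
  mul_zero f := by rw [mul_comm_aux, zero_mul_aux]
  mul_comm := mul_comm_aux
  zsmul := (inferInstance : AddCommGroup (AnalyticFunction k I)).zsmul
  nsmul := (inferInstance : AddCommGroup (AnalyticFunction k I)).nsmul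
  zsmul_zero' := (inferInstance : AddCommGroup (AnalyticFunction k I)).zsmul_zero'
  zsmul_succ' := (inferInstance : AddCommGroup (AnalyticFunction k I)).zsmul_succ'
  zsmul_neg' := (inferInstance : AddCommGroup (AnalyticFunction k I)).zsmul_neg'
  nsmul_zero := (inferInstance : AddCommGroup (AnalyticFunction k I)).nsmul_zero
  nsmul_succ := (inferInstance : AddCommGroup (AnalyticFunction k I)).nsmul_succ
  neg_add_cancel := neg_add_cancel
  sub_eq_add_neg := sub_eq_add_neg

theorem smul_mul_aux (c : k) (f g : AnalyticFunction k I) : c • f * g = c • (f * g) := by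
  ext n
  rw [coeff_smul, coeff_mul, coeff_mul, ← tsum_mul_left]
  refine tsum_congr (fun i => ?_)
  rw [coeff_smul, mul_assoc]

instance : Algebra k (AnalyticFunction k I) :=
  Algebra.ofModule smul_mul_aux (fun c f g => by rw [mul_comm, smul_mul_aux, mul_comm])

/-- The standard coordinate function `T` of `𝒜_I`. -/
def T : AnalyticFunction k I := monomial 1 1

/-- The derivative `f' = ∑ i aᵢ Tⁱ⁻¹` with respect to the standard coordinate. -/
def derivative (f : AnalyticFunction k I) : AnalyticFunction k I :=
  ⟨fun n => ((n + 1 : ℤ) : k) * f.coeff (n + 1), by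
    intro ρ hρ
    have hpos := I.pos ρ hρ
    have h := ((f.tendsto_coeff hρ).comp (add_left_injective (1 : ℤ)).tendsto_cofinite).mul_const
      ρ⁻¹
    rw [zero_mul] at h
    refine squeeze_zero (fun i => mul_nonneg (norm_nonneg _) (zpow_nonneg hpos.le _)) ?_ h
    intro i
    have h1 : ‖((i + 1 : ℤ) : k)‖ ≤ 1 := IsUltrametricDist.norm_intCast_le_one k (i + 1)
    have h2 : ρ ^ (i + 1) * ρ⁻¹ = ρ ^ i := by
      rw [zpow_add_one₀ hpos.ne', mul_assoc, mul_inv_cancel₀ hpos.ne', mul_one]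
    simp only [Function.comp_apply]
    rw [norm_mul, mul_assoc, mul_assoc, h2]
    exact mul_le_of_le_one_left (mul_nonneg (norm_nonneg _) (zpow_nonneg hpos.le _)) h1⟩

theorem coeff_derivative (f : AnalyticFunction k I) (n : ℤ) :
    (derivative f).coeff n = ((n + 1 : ℤ) : k) * f.coeff (n + 1) := rfl

theorem hasSum_coeff_mul (f g : AnalyticFunction k I) (n : ℤ) :
    HasSum (fun i : ℤ => f.coeff i * g.coeff (n - i)) ((f * g).coeff n) :=
  (summable_mul f g n).hasSum

theorem hasSum_shift {F : ℤ → k} {a : k} (h : HasSum F a) : HasSum (fun i => F (i + 1)) a :=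
  (Equiv.addRight (1 : ℤ)).hasSum_iff.2 h

theorem derivative_mul (f g : AnalyticFunction k I) :
    derivative (f * g) = f * derivative g + g * derivative f := by
  ext n
  have h1 := hasSum_shift (hasSum_coeff_mul f (derivative g) n)
  have h2 := hasSum_coeff_mul (derivative f) g n
  have h3 := hasSum_shift (hasSum_coeff_mul f g (n + 1))
  rw [mul_comm g, coeff_add, coeff_derivative]
  refine (h3.mul_left ((n + 1 : ℤ) : k)).unique ?_
  have h4 := h1.add h2
  have e : (fun i : ℤ => ((n + 1 : ℤ) : k) * (f.coeff (i + 1) * g.coeff (n + 1 - (i + 1)))) =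
      fun i : ℤ => f.coeff (i + 1) * (derivative g).coeff (n - (i + 1)) +
        (derivative f).coeff i * g.coeff (n - i) := by
    funext i
    have e1 : n + 1 - (i + 1) = n - i := by ring
    have e2 : n - (i + 1) + 1 = n - i := by ring
    rw [coeff_derivative, coeff_derivative, e1, e2]
    push_cast
    ring
  rw [e]
  exact h4

end AnalyticFunction

section Annulus

variable (k : Type*) [NormedField k] [IsUltrametricDist k] [CompleteSpace k]

/-- The Berkovich annulus `𝒜_I`, as the union over all closed subintervals `[r, R] ⊆ I` of the
Berkovich spectra of the affinoid algebras `k{R⁻¹T, rT⁻¹}`, whose norm is the maximum of the Gauss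
norms at `r` and `R`: a point is a multiplicative seminorm `f ↦ |f|_x` bounded by such a norm. It
automatically extends the absolute value of `k`. -/
structure BerkovichAnnulus (I : RadiusInterval) extends MulRingSeminorm (AnalyticFunction k I) where
  bounded : ∃ r ∈ I, ∃ R ∈ I, r ≤ R ∧
    ∀ f : AnalyticFunction k I, toFun f ≤ max (f.gaussNorm r) (f.gaussNorm R)

variable {k} {I : RadiusInterval}

/-- The absolute value `|f|_x` of a function at a point. -/
def absAt (x : BerkovichAnnulus k I) (f : AnalyticFunction k I) : ℝ := x.toMulRingSeminorm f

/-- The ideal of the functions vanishing at `x`. -/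
def vanishingIdeal (x : BerkovichAnnulus k I) : Ideal (AnalyticFunction k I) where
  carrier := {f | absAt x f = 0}
  zero_mem' := map_zero x.toMulRingSeminorm
  add_mem' := by
    intro f g hf hg
    have h1 : absAt x (f + g) ≤ absAt x f + absAt x g := map_add_le_add x.toMulRingSeminorm f g
    have h2 : 0 ≤ absAt x (f + g) := apply_nonneg x.toMulRingSeminorm (f + g)
    have hf' : absAt x f = 0 := hf
    have hg' : absAt x g = 0 := hg
    rw [hf', hg', add_zero] at h1
    exact le_antisymm h1 h2
  smul_mem' := by
    intro c f hf
    have h1 : absAt x (c * f) = absAt x c * absAt x f := map_mul x.toMulRingSeminorm c f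
    have hf' : absAt x f = 0 := hf
    rw [hf', mul_zero] at h1
    exact h1

/-- An analytic function `t` is a coordinate of `𝒜_I` if it induces an isomorphism of `𝒜_I` onto
some annulus `𝒜_J`, that is, if there is an isomorphism `𝒪(𝒜_J) ≃ 𝒪(𝒜_I)`, `T ↦ t`, under which
the points of `𝒜_I` and of `𝒜_J` correspond to each other. (The correspondence of the points makes
the isomorphism bicontinuous for the Gauss norms, hence it is the pullback of functions under
a unique isomorphism of analytic spaces.) -/
def IsCoordinate (t : AnalyticFunction k I) : Prop :=
  ∃ (J : RadiusInterval) (φ : AnalyticFunction k J ≃ₐ[k] AnalyticFunction k I),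
    φ AnalyticFunction.T = t ∧
    (∀ x : BerkovichAnnulus k I, ∃ y : BerkovichAnnulus k J, ∀ f, absAt y f = absAt x (φ f)) ∧
    (∀ y : BerkovichAnnulus k J, ∃ x : BerkovichAnnulus k I, ∀ f, absAt y f = absAt x (φ f))

variable (k I)

/-- The module `Ω¹(𝒜_I)` of differential forms, free of rank one on `dT`; the element `g` stands
for the form `g dT`. -/
def DifferentialForm : Type _ := AnalyticFunction k I

instance : AddCommGroup (DifferentialForm k I) :=
  inferInstanceAs (AddCommGroup (AnalyticFunction k I))

instance : Module (AnalyticFunction k I) (DifferentialForm k I) :=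
  inferInstanceAs (Module (AnalyticFunction k I) (AnalyticFunction k I))

instance : Module k (DifferentialForm k I) :=
  inferInstanceAs (Module k (AnalyticFunction k I))

/-- The exterior derivative `d : 𝒪(𝒜_I) → Ω¹(𝒜_I)`, `df = f' dT`. -/
def exteriorD : Derivation k (AnalyticFunction k I) (DifferentialForm k I) where
  toFun f := AnalyticFunction.derivative f
  map_add' f g := by
    refine AnalyticFunction.ext (fun n => ?_)
    exact mul_add _ _ _
  map_smul' c f := by
    refine AnalyticFunction.ext (fun n => ?_)
    exact mul_left_comm _ _ _
  map_one_eq_zero' := by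
    refine AnalyticFunction.ext (fun n => ?_)
    show ((n + 1 : ℤ) : k) * (AnalyticFunction.monomial 0 1 : AnalyticFunction k I).coeff (n + 1) = 0
    rw [AnalyticFunction.coeff_monomial]
    split_ifs with h
    · simp [h]
    · simp
  leibniz' f g := AnalyticFunction.derivative_mul f g

/-- The module of `q`-differentials on `𝒜_I`: the sections of `(Ω¹)^{⊗ q}`. -/
abbrev QDifferential (q : ℕ) : Type _ :=
  TensorPower (AnalyticFunction k I) q (DifferentialForm k I)

variable {k I}

/-- `ξ` has a zero at `x`: its image in the fibre of `(Ω¹)^{⊗ q}` at `x` is zero. -/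
def HasZeroAt {q : ℕ} (ξ : QDifferential k I q) (x : BerkovichAnnulus k I) : Prop :=
  ξ ∈ vanishingIdeal x • (⊤ : Submodule (AnalyticFunction k I) (QDifferential k I q))

/-- The `q`-differential `(dt/t)^q`, for an invertible function `t`. -/
def dlogPow (q : ℕ) (t : (AnalyticFunction k I)ˣ) : QDifferential k I q :=
  PiTensorProduct.tprod (AnalyticFunction k I)
    fun _ : Fin q => (↑t⁻¹ : AnalyticFunction k I) • exteriorD k I (t : AnalyticFunction k I)

end Annulus

end

noncomputable section

/-! Write ξ = f (dT)^q. A function without zeros has one strictly dominant Laurent term, the same at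
all radii (`exists_dominant`). Indeed a tie between two terms at some radius produces a zero
(`exists_absAt_eq_zero`, resting on `HasExtremes.exists_zero`), and the dominant index is locally
constant on a connected interval. Hence f = γ^q T^(m-q) v^q with |v - 1|_ρ < 1 for every ρ:
constants have q-th roots because k is algebraically closed, and functions close to 1 have them
because in residue characteristic zero they are exponentials.

The coordinate is sought as t = T exp(s) with s small, that is |s|_ρ < 1 for every ρ. Substituting t
for T moves each function by less than its own size in every Gauss norm, so it is an isometric
automorphism and t is a coordinate (`bijective_twistHom`, `isCoordinate_twistUnit`). With θ = T d/dT
one has dt/t = (1 + θs) dT/T, and the theorem becomes a differential equation for s.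

If m = 0, the equation v = v₀(1 + θs) is solved by dividing coefficients by nonzero integers, which
have norm one. If m ≠ 0, put e = m/q; the equation is (exp(es) + a)(1 + θs) = v. When θa = -ea,
formally θ(T^e (exp(es) + e a s)) = e T^e ((exp(es) + a)(1 + θs) - a). So it suffices to find G with
θG + eG = e(v - a), and then s with exp(es) + e a s = G. The first equation is solved
coefficientwise: the divisors i + e = (qi + m)/q have norm one except at the resonant index i =
-m/q, which exists only when q divides m. Taking for a the term of v at that index removes the
obstruction, and a is the source of the constant c₀. The second equation is a fixed point problem,
contracting because exp is the identity plus 1 up to smaller terms (`exists_expo_add_mul_eq`).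

Smallness need not be uniform near an open end of the interval, so estimates are made one radius at
a time and limits are taken in the Fréchet topology of all Gauss norms. -/

theorem RadiusInterval.mem_of_mem_Icc (I : RadiusInterval) {a b ρ : ℝ} (ha : a ∈ I) (hb : b ∈ I)
    (h : ρ ∈ Set.Icc a b) : ρ ∈ I := by
  have hI : I.carrier.OrdConnected := by
    obtain ⟨r, R, _, _, h | h | h | h⟩ := I.shape <;> rw [h]
    · exact Set.ordConnected_Icc
    · exact Set.ordConnected_Ioo
    · exact Set.ordConnected_Ico
    · exact Set.ordConnected_Ioc
  exact hI.out ha hb h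

/-! ### Gauss norms and the Fréchet topology they define. -/

namespace AnalyticFunction

variable {k : Type*} [NormedField k] {I : RadiusInterval}

@[simp]
theorem coeff_neg (f : AnalyticFunction k I) (i : ℤ) : (-f).coeff i = -f.coeff i := rfl

theorem bddAbove_coeff (f : AnalyticFunction k I) {ρ : ℝ} (hρ : ρ ∈ I) :
    BddAbove (Set.range fun i : ℤ => ‖f.coeff i‖ * ρ ^ i) :=
  (f.tendsto_coeff hρ).bddAbove_range_of_cofinite

theorem norm_coeff_mul_le_gaussNorm (f : AnalyticFunction k I) {ρ : ℝ} (hρ : ρ ∈ I) (i : ℤ) :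
    ‖f.coeff i‖ * ρ ^ i ≤ f.gaussNorm ρ :=
  le_ciSup (f.bddAbove_coeff hρ) i

theorem gaussNorm_le {f : AnalyticFunction k I} {ρ C : ℝ}
    (h : ∀ i, ‖f.coeff i‖ * ρ ^ i ≤ C) : f.gaussNorm ρ ≤ C :=
  ciSup_le h

theorem gaussNorm_nonneg (f : AnalyticFunction k I) {ρ : ℝ} (hρ : ρ ∈ I) : 0 ≤ f.gaussNorm ρ :=
  (mul_nonneg (norm_nonneg _) (zpow_nonneg (I.pos ρ hρ).le _)).trans
    (f.norm_coeff_mul_le_gaussNorm hρ 0)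

/-- The terms tend to zero, so only finitely many exceed C / 2 and the supremum stays strictly below
C. -/
theorem gaussNorm_lt {f : AnalyticFunction k I} {ρ C : ℝ} (hρ : ρ ∈ I) (hC : 0 < C)
    (h : ∀ i, ‖f.coeff i‖ * ρ ^ i < C) : f.gaussNorm ρ < C := by
  have hfin : {i : ℤ | ¬ ‖f.coeff i‖ * ρ ^ i < C / 2}.Finite :=
    eventually_cofinite.1 ((f.tendsto_coeff hρ).eventually_lt_const (half_pos hC))
  obtain ⟨D, hD, hDC⟩ : ∃ D < C, ∀ i ∈ hfin.toFinset, ‖f.coeff i‖ * ρ ^ i ≤ D := by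
    by_cases hne : hfin.toFinset.Nonempty
    · obtain ⟨j, _, hj⟩ := hfin.toFinset.exists_max_image (fun i => ‖f.coeff i‖ * ρ ^ i) hne
      exact ⟨_, h j, hj⟩
    · rw [Finset.not_nonempty_iff_eq_empty] at hne
      exact ⟨0, hC, by rw [hne]; simp⟩
  refine (gaussNorm_le (C := max D (C / 2)) fun i => ?_).trans_lt (max_lt hD (half_lt_self hC))
  by_cases hi : ‖f.coeff i‖ * ρ ^ i < C / 2
  · exact hi.le.trans (le_max_right _ _)
  · exact (hDC i (by simpa using hi)).trans (le_max_left _ _)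

@[simp]
theorem gaussNorm_zero (ρ : ℝ) : (0 : AnalyticFunction k I).gaussNorm ρ = 0 := by
  simp [gaussNorm]

@[simp]
theorem gaussNorm_neg (ρ : ℝ) (f : AnalyticFunction k I) : (-f).gaussNorm ρ = f.gaussNorm ρ := by
  simp [gaussNorm]

theorem eq_zero_of_gaussNorm_eq_zero {f : AnalyticFunction k I} {ρ : ℝ} (hρ : ρ ∈ I)
    (h : f.gaussNorm ρ = 0) : f = 0 := by
  ext i
  have h1 := f.norm_coeff_mul_le_gaussNorm hρ i
  rw [h] at h1
  have h2 := zpow_pos (I.pos ρ hρ) i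
  have : ‖f.coeff i‖ ≤ 0 := by
    by_contra h3
    exact absurd (mul_pos (not_le.1 h3) h2) (not_lt.2 h1)
  simpa using this

theorem gaussNorm_smul (c : k) (f : AnalyticFunction k I) {ρ : ℝ} (hρ : ρ ∈ I) :
    (c • f).gaussNorm ρ ≤ ‖c‖ * f.gaussNorm ρ := by
  refine gaussNorm_le fun i => ?_
  rw [coeff_smul, norm_mul, mul_assoc]
  exact mul_le_mul_of_nonneg_left (f.norm_coeff_mul_le_gaussNorm hρ i) (norm_nonneg _)

theorem gaussNorm_monomial_le (n : ℤ) (c : k) {ρ : ℝ} (hρ : ρ ∈ I) :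
    (monomial n c : AnalyticFunction k I).gaussNorm ρ ≤ ‖c‖ * ρ ^ n := by
  refine gaussNorm_le fun i => ?_
  rw [coeff_monomial]
  split_ifs with h
  · rw [h]
  · simpa using mul_nonneg (norm_nonneg c) (zpow_nonneg (I.pos ρ hρ).le n)

variable [IsUltrametricDist k]

theorem gaussNorm_add_le (f g : AnalyticFunction k I) {ρ : ℝ} (hρ : ρ ∈ I) :
    (f + g).gaussNorm ρ ≤ max (f.gaussNorm ρ) (g.gaussNorm ρ) := by
  refine gaussNorm_le fun i => ?_
  rw [coeff_add]
  have hp := zpow_nonneg (I.pos ρ hρ).le i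
  calc ‖f.coeff i + g.coeff i‖ * ρ ^ i ≤ max ‖f.coeff i‖ ‖g.coeff i‖ * ρ ^ i :=
        mul_le_mul_of_nonneg_right (IsUltrametricDist.norm_add_le_max _ _) hp
    _ = max (‖f.coeff i‖ * ρ ^ i) (‖g.coeff i‖ * ρ ^ i) := max_mul_of_nonneg _ _ hp
    _ ≤ _ := max_le_max (f.norm_coeff_mul_le_gaussNorm hρ i) (g.norm_coeff_mul_le_gaussNorm hρ i)

variable [CompleteSpace k]

@[simp]
theorem coeff_sub (f g : AnalyticFunction k I) (i : ℤ) :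
    (f - g).coeff i = f.coeff i - g.coeff i := by
  rw [sub_eq_add_neg, coeff_add, coeff_neg, sub_eq_add_neg]

theorem gaussNorm_sub_le (f g : AnalyticFunction k I) {ρ : ℝ} (hρ : ρ ∈ I) :
    (f - g).gaussNorm ρ ≤ max (f.gaussNorm ρ) (g.gaussNorm ρ) := by
  rw [sub_eq_add_neg, ← gaussNorm_neg ρ g]
  exact gaussNorm_add_le f (-g) hρ

theorem gaussNorm_mul_le (f g : AnalyticFunction k I) {ρ : ℝ} (hρ : ρ ∈ I) :
    (f * g).gaussNorm ρ ≤ f.gaussNorm ρ * g.gaussNorm ρ := by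
  refine gaussNorm_le fun n => ?_
  have hpos := I.pos ρ hρ
  have hn := zpow_pos hpos n
  rw [coeff_mul, ← le_div_iff₀ hn]
  refine norm_tsum_le_of_forall_le
    (div_nonneg (mul_nonneg (gaussNorm_nonneg f hρ) (gaussNorm_nonneg g hρ)) hn.le) fun i => ?_
  rw [le_div_iff₀ hn, norm_mul]
  have e : ρ ^ n = ρ ^ i * ρ ^ (n - i) := by rw [← zpow_add₀ hpos.ne']; congr 1; ring
  calc ‖f.coeff i‖ * ‖g.coeff (n - i)‖ * ρ ^ n
      = (‖f.coeff i‖ * ρ ^ i) * (‖g.coeff (n - i)‖ * ρ ^ (n - i)) := by rw [e]; ring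
    _ ≤ _ := mul_le_mul (f.norm_coeff_mul_le_gaussNorm hρ i)
        (g.norm_coeff_mul_le_gaussNorm hρ _)
        (mul_nonneg (norm_nonneg _) (zpow_nonneg hpos.le _)) (gaussNorm_nonneg f hρ)

theorem gaussNorm_one_le {ρ : ℝ} (hρ : ρ ∈ I) : (1 : AnalyticFunction k I).gaussNorm ρ ≤ 1 := by
  simpa [one_def] using gaussNorm_monomial_le (k := k) 0 1 hρ

theorem gaussNorm_pow_le (f : AnalyticFunction k I) {ρ : ℝ} (hρ : ρ ∈ I) (n : ℕ) :
    (f ^ n).gaussNorm ρ ≤ f.gaussNorm ρ ^ n := by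
  induction n with
  | zero => simpa using gaussNorm_one_le hρ
  | succ n ih =>
    rw [pow_succ, pow_succ]
    exact (gaussNorm_mul_le _ _ hρ).trans
      (mul_le_mul_of_nonneg_right ih (gaussNorm_nonneg f hρ))

theorem monomial_mul_monomial (m n : ℤ) (c d : k) :
    (monomial m c * monomial n d : AnalyticFunction k I) = monomial (m + n) (c * d) := by
  ext i
  rw [coeff_monomial_mul, coeff_monomial, coeff_monomial]
  have : i - m = n ↔ i = m + n := by omega
  simp [this]

theorem algebraMap_eq_monomial (c : k) :
    algebraMap k (AnalyticFunction k I) c = monomial 0 c := by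
  rw [Algebra.algebraMap_eq_smul_one]
  ext i
  rw [coeff_smul, one_def, coeff_monomial, coeff_monomial]
  simp

/-- The coordinate function as a unit. -/
def unitT : (AnalyticFunction k I)ˣ where
  val := T
  inv := monomial (-1) 1
  val_inv := by rw [T, monomial_mul_monomial]; simp [one_def]
  inv_val := by rw [T, monomial_mul_monomial]; simp [one_def]

theorem unitT_zpow (n : ℤ) : ((unitT ^ n : (AnalyticFunction k I)ˣ) : AnalyticFunction k I) =
    monomial n 1 := by
  induction n using Int.induction_on with
  | zero => simp [one_def]
  | succ n ih => rw [zpow_add_one, Units.val_mul, ih]; simp [unitT, T, monomial_mul_monomial]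
  | pred n ih =>
    rw [zpow_sub_one, Units.val_mul, ih]
    simp only [unitT, Units.inv_mk]
    rw [monomial_mul_monomial, mul_one, sub_eq_add_neg]

/-- The open subgroups `{f | |f|_ρ ≤ ε for all ρ ∈ s}`, for finite sets `s` of radii. -/
def gaussBall (p : Finset {ρ : ℝ // ρ ∈ I} × {ε : ℝ // 0 < ε}) :
    AddSubgroup (AnalyticFunction k I) where
  carrier := {f | ∀ ρ ∈ p.1, f.gaussNorm ρ ≤ p.2}
  zero_mem' := fun ρ _ => by simpa using p.2.2.le
  add_mem' := fun {f g} hf hg ρ hρ =>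
    (gaussNorm_add_le f g ρ.2).trans (max_le (hf ρ hρ) (hg ρ hρ))
  neg_mem' := fun {f} hf ρ hρ => by simpa using hf ρ hρ

instance : Nonempty (Finset {ρ : ℝ // ρ ∈ I} × {ε : ℝ // 0 < ε}) := ⟨(∅, ⟨1, one_pos⟩)⟩

theorem ringSubgroupsBasis_gaussBall :
    RingSubgroupsBasis (gaussBall : _ → AddSubgroup (AnalyticFunction k I)) := by
  classical
  refine RingSubgroupsBasis.of_comm _ ?_ ?_ ?_
  · intro p p'
    refine ⟨(p.1 ∪ p'.1, ⟨min p.2 p'.2, lt_min p.2.2 p'.2.2⟩), fun f hf => ⟨?_, ?_⟩⟩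
    · exact fun ρ hρ => (hf ρ (Finset.mem_union_left _ hρ)).trans (min_le_left _ _)
    · exact fun ρ hρ => (hf ρ (Finset.mem_union_right _ hρ)).trans (min_le_right _ _)
  · intro p
    refine ⟨(p.1, ⟨min p.2 1, lt_min p.2.2 one_pos⟩), ?_⟩
    rintro _ ⟨f, hf, g, hg, rfl⟩ ρ hρ
    have h1 : f.gaussNorm ρ ≤ p.2 := (hf ρ hρ).trans (min_le_left _ _)
    have h2 : g.gaussNorm ρ ≤ 1 := (hg ρ hρ).trans (min_le_right _ _)
    calc (f * g).gaussNorm ρ ≤ f.gaussNorm ρ * g.gaussNorm ρ := gaussNorm_mul_le f g ρ.2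
      _ ≤ p.2 * 1 := mul_le_mul h1 h2 (gaussNorm_nonneg g ρ.2) p.2.2.le
      _ = p.2 := mul_one _
  · intro f p
    -- One constant bounds the Gauss norms of `f` at the finitely many radii; the summand 1 makes it
    -- invertible.
    have hC : 0 < 1 + ∑ ρ ∈ p.1, f.gaussNorm ρ := by
      have := Finset.sum_nonneg (s := p.1) fun ρ _ => gaussNorm_nonneg f ρ.2
      linarith
    refine ⟨(p.1, ⟨p.2 / (1 + ∑ ρ ∈ p.1, f.gaussNorm ρ), div_pos p.2.2 hC⟩), ?_⟩
    intro g hg ρ hρ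
    have h1 : f.gaussNorm ρ ≤ 1 + ∑ ρ ∈ p.1, f.gaussNorm ρ := by
      have := Finset.single_le_sum (fun ρ _ => gaussNorm_nonneg f ρ.2) hρ
      linarith
    calc (f * g).gaussNorm ρ ≤ f.gaussNorm ρ * g.gaussNorm ρ := gaussNorm_mul_le f g ρ.2
      _ ≤ (1 + ∑ ρ ∈ p.1, f.gaussNorm ρ) * (p.2 / (1 + ∑ ρ ∈ p.1, f.gaussNorm ρ)) :=
          mul_le_mul h1 (hg ρ hρ) (gaussNorm_nonneg g ρ.2) hC.le
      _ = p.2 := mul_div_cancel₀ _ (ne_of_gt hC)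

/-- The Fréchet topology defined by the Gauss norms. -/
instance : UniformSpace (AnalyticFunction k I) :=
  (ringSubgroupsBasis_gaussBall (k := k)
    (I := I)).toRingFilterBasis.toAddGroupFilterBasis.uniformSpace

instance : IsUniformAddGroup (AnalyticFunction k I) :=
  (ringSubgroupsBasis_gaussBall (k := k)
    (I := I)).toRingFilterBasis.toAddGroupFilterBasis.isUniformAddGroup

instance : NonarchimedeanRing (AnalyticFunction k I) :=
  (ringSubgroupsBasis_gaussBall (k := k) (I := I)).nonarchimedean

theorem hasBasis_nhds_zero : (𝓝 (0 : AnalyticFunction k I)).HasBasis (fun _ => True)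
    fun p => ((gaussBall p : AddSubgroup (AnalyticFunction k I)) : Set (AnalyticFunction k I)) :=
  (ringSubgroupsBasis_gaussBall (k := k) (I := I)).hasBasis_nhds_zero

theorem tendsto_zero_iff {ι : Type*} {l : Filter ι} {F : ι → AnalyticFunction k I} :
    Tendsto F l (𝓝 0) ↔ ∀ ρ ∈ I, Tendsto (fun i => (F i).gaussNorm ρ) l (𝓝 0) := by
  rw [hasBasis_nhds_zero.tendsto_right_iff]
  constructor
  · intro h ρ hρ
    rw [Metric.tendsto_nhds]
    intro ε hε
    filter_upwards [h ({⟨ρ, hρ⟩}, ⟨ε / 2, half_pos hε⟩) trivial] with i hi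
    have := hi ⟨ρ, hρ⟩ (by simp)
    rw [dist_zero_right, Real.norm_of_nonneg (gaussNorm_nonneg _ hρ)]
    exact this.trans_lt (half_lt_self hε)
  · intro h p _
    have : ∀ᶠ i in l, ∀ ρ ∈ p.1, (F i).gaussNorm ρ ≤ p.2 := by
      rw [Filter.eventually_all_finset]
      intro ρ _
      exact (h ρ ρ.2).eventually_le_const p.2.2
    exact this

theorem tendsto_iff {ι : Type*} {l : Filter ι} {F : ι → AnalyticFunction k I}
    {f : AnalyticFunction k I} :
    Tendsto F l (𝓝 f) ↔ ∀ ρ ∈ I, Tendsto (fun i => (F i - f).gaussNorm ρ) l (𝓝 0) := by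
  rw [← tendsto_zero_iff, tendsto_sub_nhds_zero_iff]

instance : T2Space (AnalyticFunction k I) := by
  refine IsTopologicalAddGroup.t2Space_of_zero_sep fun f hf => ?_
  obtain ⟨ρ, hρ⟩ := I.exists_mem
  have h0 : 0 < f.gaussNorm ρ :=
    lt_of_le_of_ne (gaussNorm_nonneg f hρ) fun h => hf (eq_zero_of_gaussNorm_eq_zero hρ h.symm)
  refine ⟨_, hasBasis_nhds_zero.mem_of_mem (i := ({⟨ρ, hρ⟩}, ⟨_, half_pos h0⟩)) trivial, ?_⟩
  intro h
  have := h ⟨ρ, hρ⟩ (by simp)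
  exact absurd this (not_le.2 (half_lt_self h0))

/-- A `k`-linear map into a nonarchimedean normed group which is bounded by a Gauss norm is
continuous. -/
theorem continuous_of_gaussNorm_bound {F : Type*} [FunLike F (AnalyticFunction k I) k]
    [AddMonoidHomClass F (AnalyticFunction k I) k] (φ : F) {ρ C : ℝ} (hρ : ρ ∈ I)
    (h : ∀ f, ‖φ f‖ ≤ C * f.gaussNorm ρ) : Continuous φ := by
  refine continuous_of_continuousAt_zero φ ?_
  rw [ContinuousAt, map_zero]
  refine squeeze_zero_norm h ?_
  simpa using ((tendsto_zero_iff (F := id)).1 tendsto_id ρ hρ).const_mul C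

theorem continuous_of_gaussNorm_le {F : Type*} {J : RadiusInterval}
    [FunLike F (AnalyticFunction k I) (AnalyticFunction k J)]
    [AddMonoidHomClass F (AnalyticFunction k I) (AnalyticFunction k J)] (φ : F)
    (h : ∀ ρ ∈ J, ρ ∈ I ∧ ∃ C, ∀ f, (φ f).gaussNorm ρ ≤ C * f.gaussNorm ρ) : Continuous φ := by
  refine continuous_of_continuousAt_zero φ ?_
  rw [ContinuousAt, map_zero, tendsto_zero_iff]
  intro ρ hρ
  obtain ⟨hI, C, hC⟩ := h ρ hρ
  refine squeeze_zero (fun f => gaussNorm_nonneg _ hρ) hC ?_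
  simpa using ((tendsto_zero_iff (F := id)).1 tendsto_id ρ hI).const_mul C

/-- The coefficient functionals. -/
def coeffHom (n : ℤ) : AnalyticFunction k I →+ k where
  toFun f := f.coeff n
  map_zero' := rfl
  map_add' _ _ := rfl

theorem continuous_coeff (n : ℤ) : Continuous fun f : AnalyticFunction k I => f.coeff n := by
  obtain ⟨ρ, hρ⟩ := I.exists_mem
  refine continuous_of_gaussNorm_bound (coeffHom n) (C := (ρ ^ n)⁻¹) hρ fun f => ?_
  have h := f.norm_coeff_mul_le_gaussNorm hρ n
  rw [inv_mul_eq_div, le_div_iff₀ (zpow_pos (I.pos ρ hρ) n)]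
  exact h

/-- A Cauchy filter converges coefficientwise. The Cauchy estimate bounds all coefficients
simultaneously, so it survives the passage to the limit; this gives both the convergence of the
limit series and convergence in each Gauss norm. -/
instance : CompleteSpace (AnalyticFunction k I) := by
  refine ⟨fun {l} hl => ?_⟩
  have hne : l.NeBot := hl.1
  have hlim : ∀ n, ∃ a, Tendsto (fun f : AnalyticFunction k I => f.coeff n) l (𝓝 a) := fun n =>
    CompleteSpace.complete (hl.map
      (uniformContinuous_addMonoidHom_of_continuous (f := coeffHom n) (continuous_coeff n)))
  choose a ha using hlim
  have hcau := ((ringSubgroupsBasis_gaussBall (k := k)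
    (I := I)).toRingFilterBasis.toAddGroupFilterBasis.cauchy_iff.1 hl).2
  have key : ∀ ρ ∈ I, ∀ ε > 0, ∃ M ∈ l, ∀ f ∈ M, ∀ i, ‖f.coeff i - a i‖ * ρ ^ i ≤ ε := by
    intro ρ hρ ε hε
    obtain ⟨M, hM, h⟩ := hcau _ ((ringSubgroupsBasis_gaussBall (k := k)
      (I := I)).mem_addGroupFilterBasis ({⟨ρ, hρ⟩}, ⟨ε, hε⟩))
    refine ⟨M, hM, fun f hf i => ?_⟩
    refine le_of_tendsto ((tendsto_const_nhds.sub (ha i)).norm.mul_const (ρ ^ i)) ?_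
    filter_upwards [hM] with g hg
    rw [← coeff_sub]
    exact (norm_coeff_mul_le_gaussNorm _ hρ i).trans (h g hg f hf ⟨ρ, hρ⟩ (by simp))
  have hmem : a ∈ convergentLaurent k I := by
    intro ρ hρ
    rw [Metric.tendsto_nhds]
    intro ε hε
    obtain ⟨M, hM, h⟩ := key ρ hρ (ε / 2) (half_pos hε)
    obtain ⟨f, hf⟩ := hne.nonempty_of_mem hM
    filter_upwards [(f.tendsto_coeff hρ).eventually_lt_const hε] with i hi
    have hp := zpow_nonneg (I.pos ρ hρ).le i
    rw [dist_zero_right, Real.norm_of_nonneg (mul_nonneg (norm_nonneg _) hp)]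
    have e : a i = f.coeff i - (f.coeff i - a i) := by ring
    calc ‖a i‖ * ρ ^ i ≤ max ‖f.coeff i‖ ‖f.coeff i - a i‖ * ρ ^ i := by
          refine mul_le_mul_of_nonneg_right ?_ hp
          have h1 := IsUltrametricDist.norm_add_le_max (f.coeff i) (-(f.coeff i - a i))
          rwa [norm_neg, ← sub_eq_add_neg, ← e] at h1
      _ = max (‖f.coeff i‖ * ρ ^ i) (‖f.coeff i - a i‖ * ρ ^ i) := max_mul_of_nonneg _ _ hp
      _ < ε := max_lt hi ((h f hf i).trans_lt (half_lt_self hε))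
  refine ⟨(⟨a, hmem⟩ : AnalyticFunction k I), ?_⟩
  refine tendsto_id'.1 (tendsto_iff.2 fun ρ hρ => ?_)
  rw [Metric.tendsto_nhds]
  intro ε hε
  obtain ⟨M, hM, h⟩ := key ρ hρ (ε / 2) (half_pos hε)
  filter_upwards [hM] with f hf
  rw [dist_zero_right, Real.norm_of_nonneg (gaussNorm_nonneg _ hρ)]
  refine (gaussNorm_le fun i => ?_).trans_lt (half_lt_self hε)
  exact (congrArg (fun c => ‖c‖ * ρ ^ i) (coeff_sub f (show AnalyticFunction k I from ⟨a, hmem⟩)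
    i)).le.trans (h f hf i)

theorem summable_of_gaussNorm {ι : Type*} {F : ι → AnalyticFunction k I}
    (h : ∀ ρ ∈ I, Tendsto (fun i => (F i).gaussNorm ρ) cofinite (𝓝 0)) : Summable F :=
  NonarchimedeanAddGroup.summable_of_tendsto_cofinite_zero (tendsto_zero_iff.2 h)

theorem gaussNorm_sum_le {ι : Type*} (s : Finset ι) {F : ι → AnalyticFunction k I} {ρ C : ℝ}
    (hρ : ρ ∈ I) (hC : 0 ≤ C) (h : ∀ i ∈ s, (F i).gaussNorm ρ ≤ C) :
    (∑ i ∈ s, F i).gaussNorm ρ ≤ C := by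
  classical
  induction s using Finset.induction_on with
  | empty => simpa using hC
  | insert i s hi ih =>
    rw [Finset.sum_insert hi]
    exact (gaussNorm_add_le _ _ hρ).trans (max_le (h i (Finset.mem_insert_self i s))
      (ih fun j hj => h j (Finset.mem_insert_of_mem hj)))

/-- Closed balls of a Gauss norm are cut out by bounds on coefficients, which are continuous
functionals. -/
theorem gaussNorm_le_of_tendsto {ι : Type*} {l : Filter ι} [l.NeBot]
    {F : ι → AnalyticFunction k I} {f : AnalyticFunction k I} {ρ C : ℝ} (hρ : ρ ∈ I)
    (hF : Tendsto F l (𝓝 f)) (h : ∀ᶠ i in l, (F i).gaussNorm ρ ≤ C) : f.gaussNorm ρ ≤ C := by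
  refine gaussNorm_le fun n => ?_
  refine le_of_tendsto ((((continuous_coeff n).tendsto f).comp hF).norm.mul_const (ρ ^ n)) ?_
  filter_upwards [h] with i hi
  exact (norm_coeff_mul_le_gaussNorm _ hρ n).trans hi

theorem gaussNorm_le_of_hasSum {ι : Type*} {F : ι → AnalyticFunction k I}
    {f : AnalyticFunction k I} {ρ C : ℝ} (hρ : ρ ∈ I) (hC : 0 ≤ C) (hF : HasSum F f)
    (h : ∀ i, (F i).gaussNorm ρ ≤ C) : f.gaussNorm ρ ≤ C :=
  gaussNorm_le_of_tendsto hρ hF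
    (Eventually.of_forall fun s => gaussNorm_sum_le s hρ hC fun i _ => h i)

/-- A function is the sum of its Laurent series. -/
theorem hasSum_monomial (f : AnalyticFunction k I) : HasSum (fun i => monomial i (f.coeff i)) f := by
  have hs : Summable fun i => (monomial i (f.coeff i) : AnalyticFunction k I) :=
    summable_of_gaussNorm fun ρ hρ => squeeze_zero (fun i => gaussNorm_nonneg _ hρ)
      (fun i => gaussNorm_monomial_le i _ hρ) (f.tendsto_coeff hρ)
  convert hs.hasSum
  ext n
  have h := hs.hasSum.map (coeffHom n) (continuous_coeff n)
  refine HasSum.unique ?_ h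
  have e : (⇑(coeffHom n) ∘ fun i => (monomial i (f.coeff i) : AnalyticFunction k I)) =
      fun i => if i = n then f.coeff n else 0 := by
    funext i
    show (monomial i (f.coeff i) : AnalyticFunction k I).coeff n = _
    rw [coeff_monomial]
    by_cases hi : n = i
    · simp [hi]
    · simp [hi, Ne.symm hi]
  rw [e]
  exact hasSum_ite_eq n _

end AnalyticFunction

/-! ### Substitution into Laurent series, rational points, and contractions. -/

namespace AnalyticFunction

variable {k : Type*} [NormedField k] {I : RadiusInterval} [IsUltrametricDist k] [CompleteSpace k]

section Evaluation

variable {B : Type*} [CommRing B] [Algebra k B] [UniformSpace B] [IsUniformAddGroup B]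
  [NonarchimedeanRing B] [T2Space B]

/-- The evaluation `∑ aᵢ Tⁱ ↦ ∑ aᵢ τⁱ` at a unit `τ`. -/
def evalLinearMap (τ : Bˣ)
    (hs : ∀ f : AnalyticFunction k I,
      Summable fun i : ℤ => algebraMap k B (f.coeff i) * ((τ ^ i : Bˣ) : B)) :
    AnalyticFunction k I →ₗ[k] B where
  toFun f := ∑' i : ℤ, algebraMap k B (f.coeff i) * ((τ ^ i : Bˣ) : B)
  map_add' f g := by
    rw [← (hs f).tsum_add (hs g)]
    refine tsum_congr fun i => ?_
    rw [coeff_add, map_add, add_mul]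
  map_smul' c f := by
    rw [RingHom.id_apply, Algebra.smul_def (A := B), ← (hs f).tsum_mul_left]
    refine tsum_congr fun i => ?_
    rw [coeff_smul, map_mul, mul_assoc]

theorem hasSum_evalLinearMap (τ : Bˣ)
    (hs : ∀ f : AnalyticFunction k I,
      Summable fun i : ℤ => algebraMap k B (f.coeff i) * ((τ ^ i : Bˣ) : B))
    (f : AnalyticFunction k I) :
    HasSum (fun i : ℤ => algebraMap k B (f.coeff i) * ((τ ^ i : Bˣ) : B)) (evalLinearMap τ hs f) :=
  (hs f).hasSum

theorem evalLinearMap_monomial (τ : Bˣ)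
    (hs : ∀ f : AnalyticFunction k I,
      Summable fun i : ℤ => algebraMap k B (f.coeff i) * ((τ ^ i : Bˣ) : B)) (n : ℤ) (c : k) :
    evalLinearMap τ hs (monomial n c) = algebraMap k B c * ((τ ^ n : Bˣ) : B) := by
  show ∑' i : ℤ, _ = _
  rw [tsum_eq_single n]
  · simp [coeff_monomial]
  · intro i hi
    simp [coeff_monomial, hi]

/-- A continuous evaluation is a homomorphism of algebras. -/
def evalAlgHom (τ : Bˣ)
    (hs : ∀ f : AnalyticFunction k I,
      Summable fun i : ℤ => algebraMap k B (f.coeff i) * ((τ ^ i : Bˣ) : B))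
    (hc : Continuous (evalLinearMap τ hs)) : AnalyticFunction k I →ₐ[k] B :=
  AlgHom.ofLinearMap (evalLinearMap τ hs)
    (by rw [one_def, evalLinearMap_monomial]; simp)
    (by
      intro f g
      -- In a nonarchimedean ring the product of two sums is the sum over pairs, so multiplicativity
      -- needs checking on monomials only.
      have h1 := ((hasSum_monomial f).mul_of_nonarchimedean (hasSum_monomial g)).map
        (evalLinearMap τ hs) hc
      have h2 := ((hasSum_monomial f).map (evalLinearMap τ hs) hc).mul_of_nonarchimedean
        ((hasSum_monomial g).map (evalLinearMap τ hs) hc)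
      refine h1.unique ?_
      convert h2 using 1
      funext p
      simp only [Function.comp_apply]
      rw [monomial_mul_monomial, evalLinearMap_monomial, evalLinearMap_monomial,
        evalLinearMap_monomial, map_mul, zpow_add, Units.val_mul]
      ring)

end Evaluation

section Points

instance : NonarchimedeanRing k where
  is_nonarchimedean := NonarchimedeanAddGroup.is_nonarchimedean

theorem tendsto_coeff_mul_zpow (f : AnalyticFunction k I) (x : kˣ) (hx : ‖(x : k)‖ ∈ I) :
    Tendsto (fun i : ℤ => f.coeff i * ((x ^ i : kˣ) : k)) cofinite (𝓝 0) := by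
  rw [tendsto_zero_iff_norm_tendsto_zero]
  refine (f.tendsto_coeff hx).congr fun i => ?_
  rw [norm_mul, Units.val_zpow_eq_zpow_val, norm_zpow]

theorem summable_coeff_mul_zpow (f : AnalyticFunction k I) (x : kˣ) (hx : ‖(x : k)‖ ∈ I) :
    Summable fun i : ℤ => algebraMap k k (f.coeff i) * ((x ^ i : kˣ) : k) :=
  NonarchimedeanAddGroup.summable_of_tendsto_cofinite_zero (tendsto_coeff_mul_zpow f x hx)

theorem norm_evalLinearMap_le (x : kˣ) (hx : ‖(x : k)‖ ∈ I) (f : AnalyticFunction k I) :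
    ‖evalLinearMap x (fun f : AnalyticFunction k I => summable_coeff_mul_zpow f x hx) f‖ ≤
      f.gaussNorm ‖(x : k)‖ := by
  refine norm_tsum_le_of_forall_le (gaussNorm_nonneg f hx) fun i => ?_
  rw [norm_mul, Units.val_zpow_eq_zpow_val, norm_zpow]
  exact norm_coeff_mul_le_gaussNorm f hx i

/-- The evaluation of functions at a point of `k`. -/
def evalAt (x : kˣ) (hx : ‖(x : k)‖ ∈ I) : AnalyticFunction k I →ₐ[k] k :=
  evalAlgHom x (fun f => summable_coeff_mul_zpow f x hx)
    (continuous_of_gaussNorm_bound _ (C := 1) hx fun f => by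
      simpa using norm_evalLinearMap_le x hx f)

theorem norm_evalAt_le (x : kˣ) (hx : ‖(x : k)‖ ∈ I) (f : AnalyticFunction k I) :
    ‖evalAt x hx f‖ ≤ f.gaussNorm ‖(x : k)‖ :=
  norm_evalLinearMap_le x hx f

theorem hasSum_evalAt (x : kˣ) (hx : ‖(x : k)‖ ∈ I) (f : AnalyticFunction k I) :
    HasSum (fun i : ℤ => f.coeff i * (x : k) ^ i) (evalAt x hx f) := by
  have h := hasSum_evalLinearMap x
    (fun f : AnalyticFunction k I => summable_coeff_mul_zpow f x hx) f
  refine (congrArg (fun F => HasSum F (evalAt x hx f)) (funext fun i => ?_)).mp h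
  rw [Units.val_zpow_eq_zpow_val, Algebra.algebraMap_self_apply]

/-- The point `f ↦ |f(x)|` of the Berkovich annulus. -/
def rationalPoint (x : kˣ) (hx : ‖(x : k)‖ ∈ I) : BerkovichAnnulus k I where
  toFun f := ‖evalAt x hx f‖
  map_zero' := by simp
  add_le' f g := by rw [map_add]; exact norm_add_le _ _
  neg' f := by rw [map_neg, norm_neg]
  map_one' := by simp
  map_mul' f g := by rw [map_mul, norm_mul]
  bounded := ⟨_, hx, _, hx, le_rfl, fun f => by simpa using norm_evalAt_le x hx f⟩

theorem absAt_rationalPoint (x : kˣ) (hx : ‖(x : k)‖ ∈ I) (f : AnalyticFunction k I) :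
    absAt (rationalPoint x hx) f = ‖evalAt x hx f‖ := rfl

end Points

/-- A map that contracts all Gauss norms has a fixed point. -/
theorem exists_fixedPoint (κ K : ℝ → ℝ) (Φ : AnalyticFunction k I → AnalyticFunction k I)
    (hκ : ∀ ρ ∈ I, 0 ≤ κ ρ) (hK : ∀ ρ ∈ I, 0 ≤ K ρ ∧ K ρ < 1)
    (hmap : ∀ s, (∀ ρ ∈ I, s.gaussNorm ρ ≤ κ ρ) → ∀ ρ ∈ I, (Φ s).gaussNorm ρ ≤ κ ρ)
    (hcontr : ∀ s s', (∀ ρ ∈ I, s.gaussNorm ρ ≤ κ ρ) → (∀ ρ ∈ I, s'.gaussNorm ρ ≤ κ ρ) →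
      ∀ ρ ∈ I, (Φ s - Φ s').gaussNorm ρ ≤ K ρ * (s - s').gaussNorm ρ) :
    ∃ s, (∀ ρ ∈ I, s.gaussNorm ρ ≤ κ ρ) ∧ Φ s = s := by
  set u : ℕ → AnalyticFunction k I := fun n => Φ^[n] 0 with hu
  have hsucc : ∀ n, u (n + 1) = Φ (u n) := fun n => Function.iterate_succ_apply' Φ n 0
  have hmem : ∀ n, ∀ ρ ∈ I, (u n).gaussNorm ρ ≤ κ ρ := by
    intro n
    induction n with
    | zero => intro ρ hρ; simpa [hu] using hκ ρ hρ
    | succ n ih => rw [hsucc]; exact hmap _ ih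
  have hdiff : ∀ n, ∀ ρ ∈ I, (u (n + 1) - u n).gaussNorm ρ ≤ K ρ ^ n * (u 1 - u 0).gaussNorm ρ := by
    intro n
    induction n with
    | zero => intro ρ _; simp
    | succ n ih =>
      intro ρ hρ
      rw [pow_succ', mul_assoc]
      refine (congrArg (gaussNorm ρ) (congrArg₂ _ (hsucc (n + 1)) (hsucc n))).le.trans ?_
      exact (hcontr _ _ (hmem _) (hmem _) ρ hρ).trans
        (mul_le_mul_of_nonneg_left (ih ρ hρ) (hK ρ hρ).1)
  -- Successive differences tending to zero suffice in a nonarchimedean group, so each radius may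
  -- have its own contraction factor.
  have hcau : CauchySeq u := by
    refine NonarchimedeanAddGroup.cauchySeq_of_tendsto_sub_nhds_zero (tendsto_zero_iff.2 ?_)
    intro ρ hρ
    refine squeeze_zero (fun n => gaussNorm_nonneg _ hρ) (fun n => hdiff n ρ hρ) ?_
    simpa using (tendsto_pow_atTop_nhds_zero_of_lt_one (hK ρ hρ).1 (hK ρ hρ).2).mul_const _
  obtain ⟨s, hs⟩ := cauchySeq_tendsto_of_complete hcau
  have hsmem : ∀ ρ ∈ I, s.gaussNorm ρ ≤ κ ρ := fun ρ hρ =>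
    gaussNorm_le_of_tendsto hρ hs (Eventually.of_forall fun n => hmem n ρ hρ)
  refine ⟨s, hsmem, tendsto_nhds_unique ?_ ((tendsto_add_atTop_iff_nat 1).2 hs)⟩
  rw [tendsto_iff] at hs ⊢
  intro ρ hρ
  refine squeeze_zero (fun n => gaussNorm_nonneg _ hρ) (fun n => ?_)
    (by simpa using (hs ρ hρ).const_mul (K ρ))
  rw [hsucc]
  exact hcontr _ _ (hmem n) hsmem ρ hρ

end AnalyticFunction

/-! ### Integers in residue characteristic zero. -/

section ResidueCharacteristic

variable {k : Type*} [NormedField k] [IsUltrametricDist k]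
    [CharZero (IsLocalRing.ResidueField (NormedField.valuation (K := k)).valuationSubring)]

/-- An integer of norm less than one would vanish in the residue field. This is what excludes small
divisors: factorials, indices and the numbers qi + m, when nonzero, can be divided by without loss.
-/
theorem norm_natCast_eq_one_of_charZero_residueField {n : ℕ} (hn : n ≠ 0) : ‖(n : k)‖ = 1 := by
  refine le_antisymm (IsUltrametricDist.norm_natCast_le_one k n) (not_lt.1 fun h => ?_)
  have hn' : ((n : (NormedField.valuation (K := k)).valuationSubring) : k) = n := by simp
  have hnu : (n : (NormedField.valuation (K := k)).valuationSubring) ∈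
      IsLocalRing.maximalIdeal (NormedField.valuation (K := k)).valuationSubring := by
    rw [IsLocalRing.mem_maximalIdeal, mem_nonunits_iff]
    intro hu
    rw [Valuation.Integers.isUnit_iff_valuation_eq_one
      (Valuation.valuationSubring.integers (NormedField.valuation (K := k)))] at hu
    have h1 : NormedField.valuation (n : k) = 1 := by
      rw [← hn']; exact hu
    rw [NormedField.valuation_apply] at h1
    have h2 : ‖(n : k)‖ = 1 := by
      rw [← coe_nnnorm, h1]; rfl
    exact h.ne h2
  have h0 := (IsLocalRing.residue_eq_zero_iff _).2 hnu
  rw [map_natCast, Nat.cast_eq_zero] at h0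
  exact hn h0

theorem norm_intCast_eq_one_of_charZero_residueField {n : ℤ} (hn : n ≠ 0) : ‖(n : k)‖ = 1 := by
  obtain ⟨m, rfl | rfl⟩ := n.eq_nat_or_neg
  · rw [Int.cast_natCast]
    exact norm_natCast_eq_one_of_charZero_residueField (by simpa using hn)
  · rw [Int.cast_neg, Int.cast_natCast, norm_neg]
    exact norm_natCast_eq_one_of_charZero_residueField (by simpa using hn)

variable (k) in
theorem charZero_of_charZero_residueField : CharZero k :=
  charZero_of_inj_zero fun n hn => by
    by_contra h
    have := norm_natCast_eq_one_of_charZero_residueField (k := k) h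
    rw [hn, norm_zero] at this
    exact zero_ne_one this

end ResidueCharacteristic

theorem tsum_mul_tsum_eq_tsum_sum_antidiagonal_of_nonarchimedean {R : Type*} [CommRing R]
    [UniformSpace R] [IsUniformAddGroup R] [NonarchimedeanRing R] [T2Space R] {F G : ℕ → R}
    (hF : Summable F) (hG : Summable G) :
    (∑' n, F n) * (∑' n, G n) =
      ∑' n, ∑ p ∈ Finset.HasAntidiagonal.antidiagonal n, F p.1 * G p.2 :=
  hF.tsum_mul_tsum_eq_tsum_sum_antidiagonal hG (hF.mul_of_nonarchimedean hG)

/-! ### The Euler derivation and the exponential. -/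

namespace AnalyticFunction

variable {k : Type*} [NormedField k] {I : RadiusInterval} [IsUltrametricDist k] [CompleteSpace k]

/-- The Euler derivation `T d/dT`. -/
def euler (f : AnalyticFunction k I) : AnalyticFunction k I := T * derivative f

theorem coeff_euler (f : AnalyticFunction k I) (n : ℤ) : (euler f).coeff n = n * f.coeff n := by
  rw [euler, T, coeff_monomial_mul, coeff_derivative]
  simp

theorem euler_mul (f g : AnalyticFunction k I) : euler (f * g) = f * euler g + g * euler f := by
  simp only [euler, derivative_mul]
  ring

theorem euler_one : euler (1 : AnalyticFunction k I) = 0 := by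
  ext n
  rw [coeff_euler, one_def, coeff_monomial]
  by_cases h : n = 0 <;> simp [h]

theorem euler_smul (c : k) (f : AnalyticFunction k I) : euler (c • f) = c • euler f := by
  ext n
  simp only [coeff_euler, coeff_smul]
  ring

theorem euler_add (f g : AnalyticFunction k I) : euler (f + g) = euler f + euler g := by
  ext n
  simp only [coeff_euler, coeff_add]
  ring

theorem euler_pow_succ (f : AnalyticFunction k I) (n : ℕ) :
    euler (f ^ (n + 1)) = ((n + 1 : ℕ) : k) • (f ^ n * euler f) := by
  induction n with
  | zero => simp
  | succ n ih =>
    have e : f * (f ^ n * euler f) = f ^ (n + 1) * euler f := by ring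
    rw [pow_succ f (n + 1), euler_mul, ih, mul_smul_comm, e, Nat.cast_add (n + 1) 1, add_smul,
      Nat.cast_one, one_smul, add_comm]

theorem continuous_euler : Continuous (euler : AnalyticFunction k I → AnalyticFunction k I) := by
  let φ : AnalyticFunction k I →+ AnalyticFunction k I :=
    AddMonoidHom.mk' euler euler_add
  refine continuous_of_gaussNorm_le φ fun ρ hρ => ⟨hρ, 1, fun f => gaussNorm_le fun n => ?_⟩
  show ‖(euler f).coeff n‖ * ρ ^ n ≤ 1 * f.gaussNorm ρ
  rw [coeff_euler, norm_mul, mul_assoc, one_mul]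
  have hp := mul_nonneg (norm_nonneg (f.coeff n)) (zpow_nonneg (I.pos ρ hρ).le n)
  exact (mul_le_of_le_one_left hp (IsUltrametricDist.norm_intCast_le_one k n)).trans
    (norm_coeff_mul_le_gaussNorm f hρ n)

/-- All Gauss norms of `f` are less than one. -/
def IsSmall (f : AnalyticFunction k I) : Prop := ∀ ρ ∈ I, f.gaussNorm ρ < 1

theorem isSmall_zero : IsSmall (0 : AnalyticFunction k I) := fun ρ _ => by simp

theorem IsSmall.smul {f : AnalyticFunction k I} (hf : IsSmall f) {c : k} (hc : ‖c‖ ≤ 1) :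
    IsSmall (c • f) := fun ρ hρ =>
  ((gaussNorm_smul c f hρ).trans
    (mul_le_of_le_one_left (gaussNorm_nonneg f hρ) hc)).trans_lt (hf ρ hρ)

theorem IsSmall.neg {f : AnalyticFunction k I} (hf : IsSmall f) : IsSmall (-f) := fun ρ hρ => by
  simpa using hf ρ hρ

/-- Telescoping the difference of powers leaves n factors of size at most κ beside x - y; the
ultrametric inequality absorbs the number of summands. -/
theorem gaussNorm_pow_sub_pow_le (x y : AnalyticFunction k I) {ρ κ : ℝ} (hρ : ρ ∈ I)
    (hx : x.gaussNorm ρ ≤ κ) (hy : y.gaussNorm ρ ≤ κ) (n : ℕ) :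
    (x ^ (n + 1) - y ^ (n + 1)).gaussNorm ρ ≤ κ ^ n * (x - y).gaussNorm ρ := by
  have hκ := (gaussNorm_nonneg x hρ).trans hx
  have hxy := gaussNorm_nonneg (x - y) hρ
  induction n with
  | zero => simp
  | succ n ih =>
    have e : x ^ (n + 1 + 1) - y ^ (n + 1 + 1) =
        x * (x ^ (n + 1) - y ^ (n + 1)) + (x - y) * y ^ (n + 1) := by ring
    rw [e]
    refine (gaussNorm_add_le _ _ hρ).trans (max_le ?_ ?_)
    · refine (gaussNorm_mul_le _ _ hρ).trans ?_
      rw [pow_succ' κ, mul_assoc]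
      exact mul_le_mul hx ih (gaussNorm_nonneg _ hρ) hκ
    · refine (gaussNorm_mul_le _ _ hρ).trans ?_
      rw [mul_comm]
      refine mul_le_mul_of_nonneg_right ((gaussNorm_pow_le y hρ _).trans ?_) hxy
      exact pow_le_pow_left₀ (gaussNorm_nonneg y hρ) hy _

/-- The exponential series. It is meaningful for small functions, in residue characteristic
zero. -/
def expo (s : AnalyticFunction k I) : AnalyticFunction k I :=
  ∑' n : ℕ, ((n.factorial : k)⁻¹) • s ^ n

@[simp]
theorem expo_zero : expo (0 : AnalyticFunction k I) = 1 := by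
  rw [expo, tsum_eq_single 0]
  · simp
  · intro n hn
    simp [hn]

section Exponential

variable [CharZero (IsLocalRing.ResidueField (NormedField.valuation (K := k)).valuationSubring)]

theorem norm_factorial_inv (n : ℕ) : ‖((n.factorial : k))⁻¹‖ = 1 := by
  rw [norm_inv, norm_natCast_eq_one_of_charZero_residueField n.factorial_ne_zero, inv_one]

theorem gaussNorm_expo_term_le (s : AnalyticFunction k I) {ρ : ℝ} (hρ : ρ ∈ I) (n : ℕ) :
    (((n.factorial : k)⁻¹) • s ^ n).gaussNorm ρ ≤ s.gaussNorm ρ ^ n := by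
  refine (gaussNorm_smul _ _ hρ).trans ?_
  rw [norm_factorial_inv, one_mul]
  exact gaussNorm_pow_le s hρ n

theorem summable_expo {s : AnalyticFunction k I} (hs : IsSmall s) :
    Summable fun n : ℕ => ((n.factorial : k)⁻¹) • s ^ n := by
  refine summable_of_gaussNorm fun ρ hρ => ?_
  rw [Nat.cofinite_eq_atTop]
  exact squeeze_zero (fun n => gaussNorm_nonneg _ hρ) (fun n => gaussNorm_expo_term_le s hρ n)
    (tendsto_pow_atTop_nhds_zero_of_lt_one (gaussNorm_nonneg s hρ) (hs ρ hρ))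

theorem hasSum_expo {s : AnalyticFunction k I} (hs : IsSmall s) :
    HasSum (fun n : ℕ => ((n.factorial : k)⁻¹) • s ^ n) (expo s) :=
  (summable_expo hs).hasSum

theorem expo_term_add (x y : AnalyticFunction k I) (n : ℕ) :
    ((n.factorial : k)⁻¹) • (x + y) ^ n = ∑ p ∈ Finset.HasAntidiagonal.antidiagonal n,
      (((p.1.factorial : k)⁻¹) • x ^ p.1) * (((p.2.factorial : k)⁻¹) • y ^ p.2) := by
  have := charZero_of_charZero_residueField k
  rw [(Commute.all x y).add_pow', Finset.smul_sum]
  refine Finset.sum_congr rfl fun p hp => ?_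
  rw [Finset.HasAntidiagonal.mem_antidiagonal] at hp
  have h1 : ((n.factorial : ℕ) : k) ≠ 0 := Nat.cast_ne_zero.2 n.factorial_ne_zero
  have h2 : ((p.1.factorial : ℕ) : k) ≠ 0 := Nat.cast_ne_zero.2 p.1.factorial_ne_zero
  have h3 : ((p.2.factorial : ℕ) : k) ≠ 0 := Nat.cast_ne_zero.2 p.2.factorial_ne_zero
  have h4 : ((n.choose p.1 : ℕ) : k) * p.1.factorial * p.2.factorial = n.factorial := by
    rw [← hp]
    rw [Nat.choose_symm_add]
    exact_mod_cast Nat.add_choose_mul_factorial_mul_factorial p.1 p.2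
  have h5 : ((n.factorial : k))⁻¹ * (n.choose p.1 : k) =
      (p.1.factorial : k)⁻¹ * (p.2.factorial : k)⁻¹ := by
    field_simp
    rw [← h4]
  rw [smul_mul_assoc, mul_smul_comm, smul_smul, ← h5, mul_smul, Nat.cast_smul_eq_nsmul]

theorem expo_add {x y : AnalyticFunction k I} (hx : IsSmall x) (hy : IsSmall y) :
    expo (x + y) = expo x * expo y := by
  rw [expo, expo, expo, tsum_mul_tsum_eq_tsum_sum_antidiagonal_of_nonarchimedean
    (summable_expo hx) (summable_expo hy)]
  exact tsum_congr fun n => expo_term_add x y n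

/-- The nonlinear part of the exponential is a contraction on small functions: every term of degree
at least 2 carries a spare factor κ, and factorials have norm one. -/
theorem gaussNorm_expo_sub_expo_le {x y : AnalyticFunction k I} (hx : IsSmall x) (hy : IsSmall y)
    {ρ κ : ℝ} (hρ : ρ ∈ I) (hxκ : x.gaussNorm ρ ≤ κ) (hyκ : y.gaussNorm ρ ≤ κ) (hκ : κ ≤ 1) :
    (expo x - expo y - (x - y)).gaussNorm ρ ≤ κ * (x - y).gaussNorm ρ := by
  have hκ0 := (gaussNorm_nonneg x hρ).trans hxκ
  have hxy := gaussNorm_nonneg (x - y) hρ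
  -- The series supported at index 1 cancels the linear term of the difference.
  have h := ((hasSum_expo hx).sub (hasSum_expo hy)).sub (hasSum_ite_eq 1 (x - y))
  refine gaussNorm_le_of_hasSum hρ (mul_nonneg hκ0 hxy) h fun n => ?_
  match n with
  | 0 => simpa using mul_nonneg hκ0 hxy
  | 1 => simpa using mul_nonneg hκ0 hxy
  | n + 2 =>
    rw [if_neg (by omega), sub_zero, ← smul_sub]
    refine (gaussNorm_smul _ _ hρ).trans ?_
    rw [norm_factorial_inv, one_mul]
    refine (gaussNorm_pow_sub_pow_le x y hρ hxκ hyκ (n + 1)).trans ?_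
    refine mul_le_mul_of_nonneg_right ?_ hxy
    exact pow_le_of_le_one hκ0 hκ (by omega)

theorem gaussNorm_expo_sub_one_sub_le {s : AnalyticFunction k I} (hs : IsSmall s) {ρ : ℝ}
    (hρ : ρ ∈ I) : (expo s - 1 - s).gaussNorm ρ ≤ s.gaussNorm ρ * s.gaussNorm ρ := by
  simpa using gaussNorm_expo_sub_expo_le hs isSmall_zero hρ le_rfl
    (by simpa using gaussNorm_nonneg s hρ) (hs ρ hρ).le

theorem gaussNorm_expo_sub_one_le {s : AnalyticFunction k I} (hs : IsSmall s) {ρ : ℝ}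
    (hρ : ρ ∈ I) : (expo s - 1).gaussNorm ρ ≤ s.gaussNorm ρ := by
  have e : expo s - 1 = (expo s - 1 - s) + s := by ring
  rw [e]
  refine (gaussNorm_add_le _ _ hρ).trans (max_le ?_ le_rfl)
  exact (gaussNorm_expo_sub_one_sub_le hs hρ).trans
    (mul_le_of_le_one_left (gaussNorm_nonneg s hρ) (hs ρ hρ).le)

theorem isSmall_expo_sub_one {s : AnalyticFunction k I} (hs : IsSmall s) :
    IsSmall (expo s - 1) := fun ρ hρ => (gaussNorm_expo_sub_one_le hs hρ).trans_lt (hs ρ hρ)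

theorem gaussNorm_expo_le {s : AnalyticFunction k I} (hs : IsSmall s) {ρ : ℝ}
    (hρ : ρ ∈ I) : (expo s).gaussNorm ρ ≤ 1 := by
  have e : expo s = (expo s - 1) + 1 := by ring
  rw [e]
  exact (gaussNorm_add_le _ _ hρ).trans
    (max_le (isSmall_expo_sub_one hs ρ hρ).le (gaussNorm_one_le hρ))

theorem euler_expo {s : AnalyticFunction k I} (hs : IsSmall s) :
    euler (expo s) = expo s * euler s := by
  have := charZero_of_charZero_residueField k
  let φ : AnalyticFunction k I →+ AnalyticFunction k I := AddMonoidHom.mk' euler euler_add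
  have h := (hasSum_expo hs).map φ continuous_euler
  have h0 : φ (((Nat.factorial 0 : k)⁻¹) • s ^ 0) = 0 := by
    show euler _ = 0
    rw [pow_zero, euler_smul, euler_one, smul_zero]
  -- The constant term is killed by the derivation; dropping it shifts the index so that (n + 1) /
  -- (n + 1)! becomes 1 / n!.
  have h1 := (hasSum_nat_add_iff' 1).2 h
  simp only [Finset.sum_range_one, Function.comp_apply, h0, sub_zero] at h1
  refine h1.unique ?_
  refine (congrArg (fun F => HasSum F (expo s * euler s)) (funext fun n => ?_)).mp
    ((hasSum_expo hs).mul_right (euler s))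
  show _ = euler _
  rw [euler_smul, euler_pow_succ, smul_smul, smul_mul_assoc]
  congr 1
  rw [Nat.factorial_succ, Nat.cast_mul, mul_inv, mul_right_comm, inv_mul_cancel₀, one_mul]
  exact Nat.cast_ne_zero.2 n.succ_ne_zero

/-- The exponential of a small function, as a unit. -/
def expoUnit (s : AnalyticFunction k I) (hs : IsSmall s) : (AnalyticFunction k I)ˣ where
  val := expo s
  inv := expo (-s)
  val_inv := by rw [← expo_add hs hs.neg, add_neg_cancel, expo_zero]
  inv_val := by rw [← expo_add hs.neg hs, neg_add_cancel, expo_zero]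

theorem isSmall_intCast_smul {s : AnalyticFunction k I} (hs : IsSmall s) (n : ℤ) :
    IsSmall ((n : k) • s) := hs.smul (IsUltrametricDist.norm_intCast_le_one k n)

theorem expoUnit_zpow {s : AnalyticFunction k I} (hs : IsSmall s) (n : ℤ) :
    ((expoUnit s hs ^ n : (AnalyticFunction k I)ˣ) : AnalyticFunction k I) =
      expo ((n : k) • s) := by
  induction n using Int.induction_on with
  | zero => simp
  | succ n ih =>
    rw [zpow_add_one, Units.val_mul, ih, Int.cast_add, Int.cast_one, add_smul, one_smul,
      expo_add (isSmall_intCast_smul hs _) hs]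
    rfl
  | pred n ih =>
    rw [zpow_sub_one, Units.val_mul, ih, Int.cast_sub, Int.cast_one, sub_smul, one_smul,
      sub_eq_add_neg, expo_add (isSmall_intCast_smul hs _) hs.neg]
    rfl

theorem expo_pow {s : AnalyticFunction k I} (hs : IsSmall s) (n : ℕ) :
    expo s ^ n = expo ((n : k) • s) := by
  have h := expoUnit_zpow hs n
  rwa [zpow_natCast, Units.val_pow_eq_pow_val, Int.cast_natCast] at h

/-- Solution of the equation `exp (e s) + a s = G` in small functions `s`. -/
theorem exists_expo_add_mul_eq {e : k} (he : ‖e‖ = 1) {a G : AnalyticFunction k I}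
    (ha : IsSmall a) (hG : IsSmall (G - 1)) : ∃ s, IsSmall s ∧ expo (e • s) + a * s = G := by
  have he0 : e ≠ 0 := by rintro rfl; simp at he
  -- The solution is sought in the set of functions no larger than G - 1 at every radius.
  set κ : ℝ → ℝ := fun ρ => (G - 1).gaussNorm ρ
  have hκ0 : ∀ ρ ∈ I, 0 ≤ κ ρ := fun ρ hρ => gaussNorm_nonneg _ hρ
  have hsm : ∀ s : AnalyticFunction k I, (∀ ρ ∈ I, s.gaussNorm ρ ≤ κ ρ) → IsSmall s :=
    fun s hs ρ hρ => (hs ρ hρ).trans_lt (hG ρ hρ)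
  have hnorm : ∀ (c : k) (_ : ‖c‖ = 1) (s : AnalyticFunction k I), ∀ ρ ∈ I,
      (c • s).gaussNorm ρ ≤ s.gaussNorm ρ := fun c hc s ρ hρ => by
    simpa [hc] using gaussNorm_smul c s hρ
  have he' : ‖e⁻¹‖ = 1 := by rw [norm_inv, he, inv_one]
  have hle : ∀ s : AnalyticFunction k I, (∀ ρ ∈ I, s.gaussNorm ρ ≤ κ ρ) →
      ∀ ρ ∈ I, (e • s).gaussNorm ρ ≤ κ ρ := fun s hs ρ hρ => (hnorm e he s ρ hρ).trans (hs ρ hρ)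
  -- The equation is solved for the linear term e s; everything else on the right contracts, by the
  -- factor |a|_ρ or κ(ρ).
  suffices key : ∃ s : AnalyticFunction k I, (∀ ρ ∈ I, s.gaussNorm ρ ≤ κ ρ) ∧
      e⁻¹ • ((G - 1) - (a * s + (expo (e • s) - 1 - e • s))) = s by
    obtain ⟨s, hs, hfix⟩ := key
    refine ⟨s, hsm s hs, ?_⟩
    have h := congrArg (fun f => e • f) hfix
    simp only [smul_smul, mul_inv_cancel₀ he0, one_smul] at h
    linear_combination -h
  refine exists_fixedPoint κ (fun ρ => max (a.gaussNorm ρ) (κ ρ))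
    (fun s => e⁻¹ • ((G - 1) - (a * s + (expo (e • s) - 1 - e • s)))) hκ0
    (fun ρ hρ => ⟨(gaussNorm_nonneg a hρ).trans (le_max_left _ _), max_lt (ha ρ hρ) (hG ρ hρ)⟩)
    ?_ ?_
  · intro s hs ρ hρ
    refine (hnorm _ he' _ ρ hρ).trans ((gaussNorm_sub_le _ _ hρ).trans (max_le le_rfl ?_))
    refine (gaussNorm_add_le _ _ hρ).trans (max_le ?_ ?_)
    · refine (gaussNorm_mul_le _ _ hρ).trans ?_
      exact (mul_le_of_le_one_left (gaussNorm_nonneg s hρ) (ha ρ hρ).le).trans (hs ρ hρ)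
    · refine (gaussNorm_expo_sub_one_sub_le (hsm _ (hle s hs)) hρ).trans ?_
      exact (mul_le_of_le_one_left (gaussNorm_nonneg _ hρ) (hsm _ (hle s hs) ρ hρ).le).trans
        (hle s hs ρ hρ)
  · intro s s' hs hs' ρ hρ
    rw [← smul_sub]
    refine (hnorm _ he' _ ρ hρ).trans ?_
    have e1 : G - 1 - (a * s + (expo (e • s) - 1 - e • s)) -
        (G - 1 - (a * s' + (expo (e • s') - 1 - e • s'))) =
        -(a * (s - s') + (expo (e • s) - expo (e • s') - (e • s - e • s'))) := by ring
    rw [e1, gaussNorm_neg]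
    have hn := gaussNorm_nonneg (s - s') hρ
    refine (gaussNorm_add_le _ _ hρ).trans (max_le ?_ ?_)
    · exact (gaussNorm_mul_le _ _ hρ).trans (mul_le_mul_of_nonneg_right (le_max_left _ _) hn)
    · refine (gaussNorm_expo_sub_expo_le (hsm _ (hle s hs)) (hsm _ (hle s' hs')) hρ
        (hle s hs ρ hρ) (hle s' hs' ρ hρ) (hG ρ hρ).le).trans ?_
      refine mul_le_mul (le_max_right _ _) ?_ (gaussNorm_nonneg _ hρ)
        ((hκ0 ρ hρ).trans (le_max_right _ _))
      rw [← smul_sub]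
      exact hnorm e he _ ρ hρ

theorem exists_expo_eq {G : AnalyticFunction k I} (hG : IsSmall (G - 1)) :
    ∃ s, IsSmall s ∧ expo s = G := by
  obtain ⟨s, hs, h⟩ := exists_expo_add_mul_eq (e := 1) norm_one isSmall_zero hG
  exact ⟨s, hs, by simpa using h⟩

end Exponential

end AnalyticFunction

/-! ### The coordinates T exp s. -/

namespace AnalyticFunction

variable {k : Type*} [NormedField k] {I : RadiusInterval} [IsUltrametricDist k] [CompleteSpace k]
  [CharZero (IsLocalRing.ResidueField (NormedField.valuation (K := k)).valuationSubring)]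

/-- The unit `T exp s`, for a small function `s`. -/
def twistUnit (s : AnalyticFunction k I) (hs : IsSmall s) : (AnalyticFunction k I)ˣ :=
  unitT * expoUnit s hs

theorem twistUnit_zpow {s : AnalyticFunction k I} (hs : IsSmall s) (n : ℤ) :
    ((twistUnit s hs ^ n : (AnalyticFunction k I)ˣ) : AnalyticFunction k I) =
      monomial n 1 * expo ((n : k) • s) := by
  rw [twistUnit, mul_zpow, Units.val_mul, unitT_zpow, expoUnit_zpow]

theorem algebraMap_mul_twistUnit_zpow {s : AnalyticFunction k I} (hs : IsSmall s) (n : ℤ) (c : k) :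
    algebraMap k (AnalyticFunction k I) c *
      ((twistUnit s hs ^ n : (AnalyticFunction k I)ˣ) : AnalyticFunction k I) =
      monomial n c * expo ((n : k) • s) := by
  rw [twistUnit_zpow, ← mul_assoc, algebraMap_eq_monomial, monomial_mul_monomial, zero_add, mul_one]

/-- The n-th power of T exp s is T^n exp(n s). Since integers have norm at most one, |exp(n s) - 1|
is bounded by |s| uniformly in n. -/
theorem gaussNorm_twist_term_sub_le {s : AnalyticFunction k I} (hs : IsSmall s) (n : ℤ) (c : k)
    {ρ : ℝ} (hρ : ρ ∈ I) :
    (algebraMap k (AnalyticFunction k I) c *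
      ((twistUnit s hs ^ n : (AnalyticFunction k I)ˣ) : AnalyticFunction k I) -
      monomial n c).gaussNorm ρ ≤ s.gaussNorm ρ * (‖c‖ * ρ ^ n) := by
  have e : monomial n c * expo ((n : k) • s) - (monomial n c : AnalyticFunction k I) =
      (expo ((n : k) • s) - 1) * monomial n c := by ring
  rw [algebraMap_mul_twistUnit_zpow, e]
  refine (gaussNorm_mul_le _ _ hρ).trans (mul_le_mul ?_ (gaussNorm_monomial_le n c hρ)
    (gaussNorm_nonneg _ hρ) (gaussNorm_nonneg s hρ))
  refine (gaussNorm_expo_sub_one_le (isSmall_intCast_smul hs n) hρ).trans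
    ((gaussNorm_smul _ _ hρ).trans ?_)
  exact mul_le_of_le_one_left (gaussNorm_nonneg s hρ) (IsUltrametricDist.norm_intCast_le_one k n)

theorem summable_twist {s : AnalyticFunction k I} (hs : IsSmall s) (f : AnalyticFunction k I) :
    Summable fun i : ℤ => algebraMap k (AnalyticFunction k I) (f.coeff i) *
      ((twistUnit s hs ^ i : (AnalyticFunction k I)ˣ) : AnalyticFunction k I) := by
  refine summable_of_gaussNorm fun ρ hρ => ?_
  refine squeeze_zero (fun i => gaussNorm_nonneg _ hρ) (fun i => ?_) (f.tendsto_coeff hρ)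
  rw [algebraMap_mul_twistUnit_zpow]
  have h0 := mul_nonneg (norm_nonneg (f.coeff i)) (zpow_nonneg (I.pos ρ hρ).le i)
  calc _ ≤ (monomial i (f.coeff i)).gaussNorm ρ * (expo ((i : k) • s)).gaussNorm ρ :=
        gaussNorm_mul_le _ _ hρ
    _ ≤ (‖f.coeff i‖ * ρ ^ i) * 1 :=
        mul_le_mul (gaussNorm_monomial_le _ _ hρ) (gaussNorm_expo_le (isSmall_intCast_smul hs i) hρ)
          (gaussNorm_nonneg _ hρ) h0
    _ = _ := mul_one _

theorem gaussNorm_twist_sub_le {s : AnalyticFunction k I} (hs : IsSmall s)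
    (f : AnalyticFunction k I) {ρ : ℝ} (hρ : ρ ∈ I) :
    (evalLinearMap (twistUnit s hs) (summable_twist hs) f - f).gaussNorm ρ ≤
      s.gaussNorm ρ * f.gaussNorm ρ := by
  have h := (hasSum_evalLinearMap (twistUnit s hs) (summable_twist hs) f).sub (hasSum_monomial f)
  refine gaussNorm_le_of_hasSum hρ (mul_nonneg (gaussNorm_nonneg s hρ) (gaussNorm_nonneg f hρ)) h
    fun i => ?_
  exact (gaussNorm_twist_term_sub_le hs i _ hρ).trans
    (mul_le_mul_of_nonneg_left (norm_coeff_mul_le_gaussNorm f hρ i) (gaussNorm_nonneg s hρ))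

/-- The substitution changes a nonzero f by strictly less than its norm, and such a perturbation
preserves an ultrametric norm. -/
theorem gaussNorm_twist {s : AnalyticFunction k I} (hs : IsSmall s)
    (f : AnalyticFunction k I) {ρ : ℝ} (hρ : ρ ∈ I) :
    (evalLinearMap (twistUnit s hs) (summable_twist hs) f).gaussNorm ρ = f.gaussNorm ρ := by
  set g := evalLinearMap (twistUnit s hs) (summable_twist hs) f
  have h : (g - f).gaussNorm ρ ≤ s.gaussNorm ρ * f.gaussNorm ρ := gaussNorm_twist_sub_le hs f hρ
  have hf := gaussNorm_nonneg f hρ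
  have h1 := hs ρ hρ
  apply le_antisymm
  · have e : g = (g - f) + f := by ring
    rw [e]
    exact (gaussNorm_add_le _ _ hρ).trans
      (max_le (h.trans (mul_le_of_le_one_left hf h1.le)) le_rfl)
  · by_contra hlt
    rw [not_le] at hlt
    have hf0 : 0 < f.gaussNorm ρ := (gaussNorm_nonneg g hρ).trans_lt hlt
    have e : f = g - (g - f) := by ring
    have h2 := gaussNorm_sub_le g (g - f) hρ
    rw [← e] at h2
    have h3 : (g - f).gaussNorm ρ < f.gaussNorm ρ :=
      h.trans_lt (mul_lt_of_lt_one_left hf0 h1)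
    exact absurd h2 (not_le.2 (max_lt hlt h3))

/-- Substitution of `T exp s` for `T`. -/
def twistHom (s : AnalyticFunction k I) (hs : IsSmall s) :
    AnalyticFunction k I →ₐ[k] AnalyticFunction k I :=
  evalAlgHom (twistUnit s hs) (summable_twist hs)
    (continuous_of_gaussNorm_le _ fun ρ hρ => ⟨hρ, 1, fun f => by
      rw [gaussNorm_twist hs f hρ, one_mul]⟩)

theorem gaussNorm_twistHom {s : AnalyticFunction k I} (hs : IsSmall s)
    (f : AnalyticFunction k I) {ρ : ℝ} (hρ : ρ ∈ I) :
    (twistHom s hs f).gaussNorm ρ = f.gaussNorm ρ := gaussNorm_twist hs f hρ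

theorem gaussNorm_twistHom_sub_le {s : AnalyticFunction k I} (hs : IsSmall s)
    (f : AnalyticFunction k I) {ρ : ℝ} (hρ : ρ ∈ I) :
    (twistHom s hs f - f).gaussNorm ρ ≤ s.gaussNorm ρ * f.gaussNorm ρ :=
  gaussNorm_twist_sub_le hs f hρ

theorem twistHom_T {s : AnalyticFunction k I} (hs : IsSmall s) :
    twistHom s hs T = (twistUnit s hs : AnalyticFunction k I) := by
  refine (evalLinearMap_monomial (twistUnit s hs) (summable_twist hs) 1 1).trans ?_
  simp

/-- An isometry is injective. For surjectivity, a preimage of g is a fixed point of f ↦ g - (φ f -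
f), which contracts by the factor |s|_ρ. -/
theorem bijective_twistHom {s : AnalyticFunction k I} (hs : IsSmall s) :
    Function.Bijective (twistHom s hs) := by
  constructor
  · rw [injective_iff_map_eq_zero]
    intro f hf
    obtain ⟨ρ, hρ⟩ := I.exists_mem
    refine eq_zero_of_gaussNorm_eq_zero hρ ?_
    rw [← gaussNorm_twistHom hs f hρ, hf, gaussNorm_zero]
  · intro g
    suffices h : ∃ f : AnalyticFunction k I, (∀ ρ ∈ I, f.gaussNorm ρ ≤ g.gaussNorm ρ) ∧
        g - (twistHom s hs f - f) = f by
      obtain ⟨f, _, hf⟩ := h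
      exact ⟨f, by linear_combination -hf⟩
    refine exists_fixedPoint (fun ρ => g.gaussNorm ρ) (fun ρ => s.gaussNorm ρ)
      (fun f => g - (twistHom s hs f - f)) (fun ρ hρ => gaussNorm_nonneg g hρ)
      (fun ρ hρ => ⟨gaussNorm_nonneg s hρ, hs ρ hρ⟩) ?_ ?_
    · intro f hf ρ hρ
      refine (gaussNorm_sub_le _ _ hρ).trans (max_le le_rfl ?_)
      exact (gaussNorm_twistHom_sub_le hs f hρ).trans
        ((mul_le_of_le_one_left (gaussNorm_nonneg f hρ) (hs ρ hρ).le).trans (hf ρ hρ))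
    · intro f f' _ _ ρ hρ
      have e : g - (twistHom s hs f - f) - (g - (twistHom s hs f' - f')) =
          -(twistHom s hs (f - f') - (f - f')) := by rw [map_sub]; ring
      rw [e, gaussNorm_neg]
      exact gaussNorm_twistHom_sub_le hs _ hρ

/-- The pullback of a point under an isometric automorphism. -/
def comapPoint (φ : AnalyticFunction k I →ₐ[k] AnalyticFunction k I)
    (hφ : ∀ f, ∀ ρ ∈ I, (φ f).gaussNorm ρ = f.gaussNorm ρ) (x : BerkovichAnnulus k I) :
    BerkovichAnnulus k I where
  toFun f := absAt x (φ f)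
  map_zero' := by rw [map_zero]; exact map_zero x.toMulRingSeminorm
  add_le' f g := by rw [map_add]; exact map_add_le_add x.toMulRingSeminorm _ _
  neg' f := by rw [map_neg]; exact map_neg_eq_map x.toMulRingSeminorm _
  map_one' := by rw [map_one]; exact map_one x.toMulRingSeminorm
  map_mul' f g := by rw [map_mul]; exact map_mul x.toMulRingSeminorm _ _
  bounded := by
    obtain ⟨r, hr, R, hR, hrR, h⟩ := x.bounded
    refine ⟨r, hr, R, hR, hrR, fun f => ?_⟩
    have := h (φ f)
    rw [hφ f r hr, hφ f R hR] at this
    exact this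

/-- The target annulus is the same one. The substitution and its inverse preserve all Gauss norms,
so pulling back along either keeps the bound that defines a point. -/
theorem isCoordinate_twistUnit {s : AnalyticFunction k I} (hs : IsSmall s) :
    IsCoordinate (twistUnit s hs : AnalyticFunction k I) := by
  let φ : AnalyticFunction k I ≃ₐ[k] AnalyticFunction k I :=
    AlgEquiv.ofBijective (twistHom s hs) (bijective_twistHom hs)
  have hφ : ∀ f, ∀ ρ ∈ I, (φ f).gaussNorm ρ = f.gaussNorm ρ := fun f ρ hρ =>
    gaussNorm_twistHom hs f hρ
  refine ⟨I, φ, twistHom_T hs, fun x => ⟨comapPoint φ.toAlgHom hφ x, fun f => rfl⟩, fun y => ?_⟩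
  refine ⟨comapPoint φ.symm.toAlgHom (fun f ρ hρ => ?_) y, fun f => ?_⟩
  · have h := hφ (φ.symm f) ρ hρ
    rw [AlgEquiv.apply_symm_apply] at h
    exact h.symm
  · show absAt y f = absAt y (φ.symm (φ f))
    rw [AlgEquiv.symm_apply_apply]

theorem absAt_mul (x : BerkovichAnnulus k I) (f g : AnalyticFunction k I) :
    absAt x (f * g) = absAt x f * absAt x g := map_mul x.toMulRingSeminorm f g

theorem absAt_one (x : BerkovichAnnulus k I) : absAt x 1 = 1 := map_one x.toMulRingSeminorm

theorem absAt_nonneg (x : BerkovichAnnulus k I) (f : AnalyticFunction k I) : 0 ≤ absAt x f :=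
  apply_nonneg x.toMulRingSeminorm f

theorem absAt_le_of_gaussNorm_le (x : BerkovichAnnulus k I) {f : AnalyticFunction k I} {C : ℝ}
    (h : ∀ ρ ∈ I, f.gaussNorm ρ ≤ C) : absAt x f ≤ C := by
  obtain ⟨r, hr, R, hR, _, hb⟩ := x.bounded
  exact (hb f).trans (max_le (h r hr) (h R hR))

theorem absAt_lt_of_gaussNorm_lt (x : BerkovichAnnulus k I) {f : AnalyticFunction k I} {C : ℝ}
    (h : ∀ ρ ∈ I, f.gaussNorm ρ < C) : absAt x f < C := by
  obtain ⟨r, hr, R, hR, _, hb⟩ := x.bounded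
  exact (hb f).trans_lt (max_lt (h r hr) (h R hR))

/-- Both exp(s) and its inverse exp(-s) are bounded by 1. -/
theorem absAt_expo (x : BerkovichAnnulus k I) {s : AnalyticFunction k I} (hs : IsSmall s) :
    absAt x (expo s) = 1 := by
  have h1 : absAt x (expo s) ≤ 1 := absAt_le_of_gaussNorm_le x fun ρ hρ => gaussNorm_expo_le hs hρ
  have h2 : absAt x (expo (-s)) ≤ 1 :=
    absAt_le_of_gaussNorm_le x fun ρ hρ => gaussNorm_expo_le hs.neg hρ
  have h3 : absAt x (expo s) * absAt x (expo (-s)) = 1 := by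
    rw [← absAt_mul, ← expo_add hs hs.neg, add_neg_cancel, expo_zero, absAt_one]
  refine le_antisymm h1 ?_
  rw [← h3]
  exact mul_le_of_le_one_right (absAt_nonneg x _) h2

end AnalyticFunction

/-! ### Newton polygons on the unit circle and zeros of two-sided series. -/

section Roots

variable {k : Type*} [NormedField k] [IsUltrametricDist k]

theorem norm_sub_le_max_of_ultrametric (x y : k) : ‖x - y‖ ≤ max ‖x‖ ‖y‖ := by
  have h := IsUltrametricDist.norm_add_le_max x (-y)
  rwa [norm_neg, ← sub_eq_add_neg] at h

theorem norm_sub_eq_left_of_norm_lt {x y : k} (h : ‖y‖ < ‖x‖) : ‖x - y‖ = ‖x‖ := by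
  have h1 := IsUltrametricDist.norm_add_eq_max_of_norm_ne_norm (x := x) (y := -y)
    (by rw [norm_neg]; exact h.ne')
  rwa [norm_neg, ← sub_eq_add_neg, max_eq_left h.le] at h1

theorem norm_sub_eq_right_of_norm_lt {x y : k} (h : ‖x‖ < ‖y‖) : ‖x - y‖ = ‖y‖ := by
  rw [norm_sub_rev, norm_sub_eq_left_of_norm_lt h]

/-- `M` is the maximal norm of the terms of `a`, and `l` and `u` are the least and the greatest
index at which it is attained. -/
structure HasExtremes (a : ℤ → k) (l u : ℤ) (M : ℝ) : Prop where
  pos : 0 < M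
  le : ∀ i, ‖a i‖ ≤ M
  left : ‖a l‖ = M
  right : ‖a u‖ = M
  lt_left : ∀ i < l, ‖a i‖ < M
  lt_right : ∀ i > u, ‖a i‖ < M

namespace HasExtremes

variable {a : ℤ → k} {l u : ℤ} {M : ℝ}

theorem unique (h : HasExtremes a l u M) {l' u' : ℤ} {M' : ℝ} (h' : HasExtremes a l' u' M') :
    l = l' ∧ u = u' ∧ M = M' := by
  have hM : M = M' := le_antisymm (h.left ▸ h'.le l) (h'.left ▸ h.le l')
  subst hM
  refine ⟨le_antisymm ?_ ?_, le_antisymm ?_ ?_, rfl⟩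
  · exact not_lt.1 fun hlt => (h.lt_left _ hlt).ne h'.left
  · exact not_lt.1 fun hlt => (h'.lt_left _ hlt).ne h.left
  · exact not_lt.1 fun hlt => (h'.lt_right _ hlt).ne h.right
  · exact not_lt.1 fun hlt => (h.lt_right _ hlt).ne h'.right

theorem const_mul (h : HasExtremes a l u M) {c : k} (hc : c ≠ 0) :
    HasExtremes (fun i => c * a i) l u (‖c‖ * M) := by
  have hc' := norm_pos_iff.2 hc
  refine ⟨mul_pos hc' h.pos, fun i => ?_, ?_, ?_, fun i hi => ?_, fun i hi => ?_⟩ <;>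
    rw [norm_mul]
  · exact mul_le_mul_of_nonneg_left (h.le i) hc'.le
  · rw [h.left]
  · rw [h.right]
  · exact mul_lt_mul_of_pos_left (h.lt_left i hi) hc'
  · exact mul_lt_mul_of_pos_left (h.lt_right i hi) hc'

/-- This and the next two lemmas follow the extremal indices under multiplication by X - β: a root
inside the unit circle shifts both, a root outside shifts neither, and a root on the circle moves
only the upper one. Thus u - l counts the roots of norm one. -/
theorem mul_linear_of_lt (h : HasExtremes a l u M) {β : k} (hβ : ‖β‖ < 1) :
    HasExtremes (fun i => a (i - 1) - β * a i) (l + 1) (u + 1) M := by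
  have hb : ∀ i, ‖β * a i‖ < M := fun i => by
    rw [norm_mul]
    exact (mul_le_mul_of_nonneg_left (h.le i) (norm_nonneg β)).trans_lt
      (mul_lt_of_lt_one_left h.pos hβ)
  refine ⟨h.pos, fun i => ?_, ?_, ?_, fun i hi => ?_, fun i hi => ?_⟩
  · exact (norm_sub_le_max_of_ultrametric _ _).trans (max_le (h.le _) (hb i).le)
  · rw [add_sub_cancel_right, norm_sub_eq_left_of_norm_lt (by rw [h.left]; exact hb _), h.left]
  · rw [add_sub_cancel_right, norm_sub_eq_left_of_norm_lt (by rw [h.right]; exact hb _), h.right]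
  · exact (norm_sub_le_max_of_ultrametric _ _).trans_lt (max_lt (h.lt_left _ (by omega)) (hb i))
  · exact (norm_sub_le_max_of_ultrametric _ _).trans_lt (max_lt (h.lt_right _ (by omega)) (hb i))

theorem mul_linear_of_gt (h : HasExtremes a l u M) {β : k} (hβ : 1 < ‖β‖) :
    HasExtremes (fun i => a (i - 1) - β * a i) l u (‖β‖ * M) := by
  have hβ0 : 0 < ‖β‖ := one_pos.trans hβ
  have hM : M < ‖β‖ * M := lt_mul_of_one_lt_left h.pos hβ
  have ha : ∀ i, ‖a i‖ < ‖β‖ * M := fun i => (h.le i).trans_lt hM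
  refine ⟨mul_pos hβ0 h.pos, fun i => ?_, ?_, ?_, fun i hi => ?_, fun i hi => ?_⟩
  · refine (norm_sub_le_max_of_ultrametric _ _).trans (max_le (ha _).le ?_)
    rw [norm_mul]
    exact mul_le_mul_of_nonneg_left (h.le i) hβ0.le
  · rw [norm_sub_eq_right_of_norm_lt (by rw [norm_mul, h.left]; exact ha _), norm_mul, h.left]
  · rw [norm_sub_eq_right_of_norm_lt (by rw [norm_mul, h.right]; exact ha _), norm_mul, h.right]
  · refine (norm_sub_le_max_of_ultrametric _ _).trans_lt (max_lt (ha _) ?_)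
    rw [norm_mul]
    exact mul_lt_mul_of_pos_left (h.lt_left _ hi) hβ0
  · refine (norm_sub_le_max_of_ultrametric _ _).trans_lt (max_lt (ha _) ?_)
    rw [norm_mul]
    exact mul_lt_mul_of_pos_left (h.lt_right _ hi) hβ0

theorem mul_linear_of_eq (h : HasExtremes a l u M) {β : k} (hβ : ‖β‖ = 1) :
    HasExtremes (fun i => a (i - 1) - β * a i) l (u + 1) M := by
  have hlu : l ≤ u := not_lt.1 fun hlt => (h.lt_left _ hlt).ne h.right
  have hb : ∀ i, ‖β * a i‖ = ‖a i‖ := fun i => by rw [norm_mul, hβ, one_mul]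
  refine ⟨h.pos, fun i => ?_, ?_, ?_, fun i hi => ?_, fun i hi => ?_⟩
  · exact (norm_sub_le_max_of_ultrametric _ _).trans (max_le (h.le _) ((hb i).le.trans (h.le i)))
  · rw [norm_sub_eq_right_of_norm_lt, hb, h.left]
    rw [hb, h.left]
    exact h.lt_left _ (by omega)
  · rw [add_sub_cancel_right, norm_sub_eq_left_of_norm_lt, h.right]
    rw [hb, h.right]
    exact h.lt_right _ (by omega)
  · exact (norm_sub_le_max_of_ultrametric _ _).trans_lt
      (max_lt (h.lt_left _ (by omega)) ((hb i).le.trans_lt (h.lt_left _ hi)))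
  · exact (norm_sub_le_max_of_ultrametric _ _).trans_lt
      (max_lt (h.lt_right _ (by omega)) ((hb i).le.trans_lt (h.lt_right _ (by omega))))

end HasExtremes

open Polynomial

/-- The coefficients of a polynomial, extended by zero to the negative indices. -/
def intCoeff (p : k[X]) (i : ℤ) : k := if 0 ≤ i then p.coeff i.toNat else 0

theorem intCoeff_mul_X_sub_C (p : k[X]) (β : k) (i : ℤ) :
    intCoeff (p * (X - C β)) i = intCoeff p (i - 1) - β * intCoeff p i := by
  unfold intCoeff
  rcases lt_trichotomy i 0 with h | rfl | h
  · rw [if_neg (by omega), if_neg (by omega), if_neg (by omega)]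
    simp
  · simp [mul_comm]
  · obtain ⟨n, rfl⟩ : ∃ n : ℕ, i = n + 1 := ⟨(i - 1).toNat, by omega⟩
    rw [if_pos (by omega), if_pos (by omega), if_pos (by omega)]
    have e1 : ((n : ℤ) + 1).toNat = n + 1 := by omega
    have e2 : ((n : ℤ) + 1 - 1).toNat = n := by omega
    rw [e1, e2, coeff_mul_X_sub_C, mul_comm β]

theorem intCoeff_C_mul (p : k[X]) (c : k) (i : ℤ) : intCoeff (C c * p) i = c * intCoeff p i := by
  unfold intCoeff
  split_ifs <;> simp

/-- The norm of a split polynomial on the unit circle is governed by the roots of norm one, whose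
number is the difference of the extremal indices of its coefficients. -/
theorem exists_unit_roots_of_multiset (S : Multiset k) :
    ∃ (l : ℤ) (s : Multiset k) (M : ℝ),
      HasExtremes (intCoeff (S.map (X - C ·)).prod) l (l + s.card) M ∧
      (∀ β ∈ s, ‖β‖ = 1 ∧ β ∈ S) ∧
      ∀ z : k, ‖z‖ = 1 → ‖((S.map (X - C ·)).prod).eval z‖ = M * (s.map (‖z - ·‖)).prod := by
  induction S using Multiset.induction_on with
  | empty =>
    refine ⟨0, 0, 1, ⟨one_pos, fun i => ?_, ?_, ?_, fun i hi => ?_, fun i hi => ?_⟩, by simp,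
      by simp⟩
    · unfold intCoeff
      split_ifs
      · rw [Multiset.map_zero, Multiset.prod_zero, coeff_one]
        split_ifs <;> simp
      · simp
    · simp [intCoeff]
    · simp [intCoeff]
    · simp [intCoeff, not_le.2 hi]
    · have hi' : i.toNat ≠ 0 := by simp at hi; omega
      have : (0 : ℤ) ≤ i := by simp at hi; omega
      simp [intCoeff, this, coeff_one, hi']
  | cons β S ih =>
    obtain ⟨l, s, M, hM, hs, heval⟩ := ih
    have e : ((β ::ₘ S).map (X - C ·)).prod = (S.map (X - C ·)).prod * (X - C β) := by
      rw [Multiset.map_cons, Multiset.prod_cons, mul_comm]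
    have ec : intCoeff ((S.map (X - C ·)).prod * (X - C β)) = fun i =>
        intCoeff (S.map (X - C ·)).prod (i - 1) - β * intCoeff (S.map (X - C ·)).prod i :=
      funext fun i => intCoeff_mul_X_sub_C _ β i
    have hs' : ∀ γ ∈ s, ‖γ‖ = 1 ∧ γ ∈ β ::ₘ S := fun γ hγ =>
      ⟨(hs γ hγ).1, Multiset.mem_cons_of_mem (hs γ hγ).2⟩
    rw [e, ec]
    rcases lt_trichotomy ‖β‖ 1 with h | h | h
    · refine ⟨l + 1, s, M, ?_, hs', fun z hz => ?_⟩
      · have := hM.mul_linear_of_lt h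
        rwa [add_right_comm] at this
      · rw [eval_mul, norm_mul, heval z hz, eval_sub, eval_X, eval_C,
          norm_sub_eq_left_of_norm_lt (by rwa [hz]), hz, mul_one]
    · refine ⟨l, β ::ₘ s, M, ?_, ?_, fun z hz => ?_⟩
      · have := hM.mul_linear_of_eq h
        rw [Multiset.card_cons, Nat.cast_add, Nat.cast_one, ← add_assoc]
        exact this
      · intro γ hγ
        rcases Multiset.mem_cons.1 hγ with rfl | hγ
        · exact ⟨h, Multiset.mem_cons_self _ _⟩
        · exact hs' γ hγ
      · rw [eval_mul, norm_mul, heval z hz, eval_sub, eval_X, eval_C, Multiset.map_cons,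
          Multiset.prod_cons]
        ring
    · refine ⟨l, s, ‖β‖ * M, hM.mul_linear_of_gt h, hs', fun z hz => ?_⟩
      rw [eval_mul, norm_mul, heval z hz, eval_sub, eval_X, eval_C,
        norm_sub_eq_right_of_norm_lt (by rwa [hz])]
      ring

/-- Over an algebraically closed field the polynomial is its leading coefficient times linear
factors; uniqueness of the extremal data identifies those of the product with the given ones. -/
theorem exists_unit_roots [IsAlgClosed k] {P : k[X]} {l u : ℤ} {M : ℝ}
    (hP : HasExtremes (intCoeff P) l u M) :
    ∃ s : Multiset k, u = l + s.card ∧ (∀ β ∈ s, ‖β‖ = 1 ∧ P.eval β = 0) ∧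
      ∀ z : k, ‖z‖ = 1 → ‖P.eval z‖ = M * (s.map (‖z - ·‖)).prod := by
  have hP0 : P ≠ 0 := by
    rintro rfl
    have := hP.left
    simp [intCoeff] at this
    exact hP.pos.ne this
  obtain ⟨l', s, M', hM', hs, heval⟩ := exists_unit_roots_of_multiset P.roots
  have hc : P.leadingCoeff ≠ 0 := leadingCoeff_ne_zero.2 hP0
  have e := (IsAlgClosed.splits P).eq_prod_roots
  have h1 := hM'.const_mul hc
  have ec : (fun i => P.leadingCoeff * intCoeff (P.roots.map (X - C ·)).prod i) = intCoeff P := by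
    funext i
    rw [← intCoeff_C_mul, ← e]
  rw [ec] at h1
  obtain ⟨rfl, hu, hM⟩ := hP.unique h1
  refine ⟨s, hu, fun β hβ => ⟨(hs β hβ).1, (mem_roots hP0).1 (hs β hβ).2⟩, fun z hz => ?_⟩
  rw [e, eval_mul, norm_mul, heval z hz, eval_C, hM, mul_assoc]

/-- The truncation `∑_{|i| ≤ N} bᵢ Xⁱ⁺ᴺ` of a two-sided series. -/
def truncPoly (b : ℤ → k) (N : ℕ) : k[X] :=
  ∑ j ∈ Finset.range (2 * N + 1), C (b (j - N)) * X ^ j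

theorem intCoeff_truncPoly (b : ℤ → k) (N : ℕ) (i : ℤ) :
    intCoeff (truncPoly b N) i = if -(N : ℤ) ≤ i - N ∧ i - N ≤ N then b (i - N) else 0 := by
  unfold intCoeff truncPoly
  by_cases h : 0 ≤ i
  · obtain ⟨n, rfl⟩ := Int.eq_ofNat_of_zero_le h
    rw [if_pos h]
    simp only [finsetSum_coeff, coeff_C_mul, coeff_X_pow, Int.toNat_natCast]
    by_cases hn : n < 2 * N + 1
    · rw [if_pos (by omega), Finset.sum_eq_single n]
      · simp
      · intro j _ hj
        simp [Ne.symm hj]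
      · intro h'
        exact absurd (Finset.mem_range.2 hn) h'
    · rw [if_neg (by omega)]
      refine Finset.sum_eq_zero fun j hj => ?_
      rw [Finset.mem_range] at hj
      rw [if_neg (by omega), mul_zero]
  · rw [if_neg h, if_neg (by omega)]

theorem HasExtremes.truncPoly {b : ℤ → k} {l u : ℤ} {M : ℝ} (h : HasExtremes b l u M) {N : ℕ}
    (hl : -(N : ℤ) ≤ l) (hu : u ≤ N) :
    HasExtremes (intCoeff (truncPoly b N)) (l + N) (u + N) M := by
  have hlu : l ≤ u := not_lt.1 fun hlt => (h.lt_left _ hlt).ne h.right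
  refine ⟨h.pos, fun i => ?_, ?_, ?_, fun i hi => ?_, fun i hi => ?_⟩ <;> rw [intCoeff_truncPoly]
  · split_ifs
    · exact h.le _
    · simpa using h.pos.le
  · rw [if_pos (by omega), add_sub_cancel_right, h.left]
  · rw [if_pos (by omega), add_sub_cancel_right, h.right]
  · split_ifs
    · exact h.lt_left _ (by omega)
    · simpa using h.pos
  · split_ifs
    · exact h.lt_right _ (by omega)
    · simpa using h.pos

theorem eval_truncPoly (b : ℤ → k) (N : ℕ) (z : k) :
    (truncPoly b N).eval z = ∑ j ∈ Finset.range (2 * N + 1), b (j - N) * z ^ j := by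
  simp [truncPoly, eval_finsetSum]

/-- Enlarging the truncation adds only two outer coefficients, so on the unit circle a root of one
truncation is an approximate root of the next. -/
theorem eval_truncPoly_succ (b : ℤ → k) (N : ℕ) (z : k) :
    (truncPoly b (N + 1)).eval z =
      z * (truncPoly b N).eval z + (b (-(N + 1 : ℕ)) + b (N + 1 : ℕ) * z ^ (2 * N + 2)) := by
  rw [eval_truncPoly, eval_truncPoly, show 2 * (N + 1) + 1 = (2 * N + 1 + 1) + 1 by ring,
    Finset.sum_range_succ, Finset.sum_range_succ', Finset.mul_sum]
  have e1 : ∀ j : ℕ, ((j + 1 : ℕ) : ℤ) - ((N + 1 : ℕ) : ℤ) = j - N := fun j => by push_cast; ring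
  have e2 : ((2 * N + 1 + 1 : ℕ) : ℤ) - ((N + 1 : ℕ) : ℤ) = (N + 1 : ℕ) := by push_cast; ring
  have e3 : ((0 : ℕ) : ℤ) - ((N + 1 : ℕ) : ℤ) = -(N + 1 : ℕ) := by push_cast; ring
  rw [e2, e3, pow_zero, mul_one, add_assoc]
  congr 1
  refine Finset.sum_congr rfl fun j _ => ?_
  rw [e1, pow_succ]
  ring

theorem eval_truncPoly_eq_sum_Icc (b : ℤ → k) (N : ℕ) {z : k} (hz : z ≠ 0) :
    (truncPoly b N).eval z = z ^ N * ∑ i ∈ Finset.Icc (-(N : ℤ)) N, b i * z ^ i := by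
  rw [eval_truncPoly, Finset.mul_sum]
  refine Finset.sum_bij' (fun j _ => (j : ℤ) - N) (fun i _ => (i + N).toNat) ?_ ?_ ?_ ?_ ?_
  · intro j hj
    rw [Finset.mem_range] at hj
    rw [Finset.mem_Icc]
    omega
  · intro i hi
    rw [Finset.mem_Icc] at hi
    rw [Finset.mem_range]
    omega
  · intro j _
    simp
  · intro i hi
    rw [Finset.mem_Icc] at hi
    omega
  · intro j _
    rw [mul_left_comm, ← zpow_natCast z N, ← zpow_add₀ hz, add_sub_cancel, zpow_natCast]

theorem exists_seq_of_forall_step {α : Type*} (Q : ℕ → α → Prop) (R : ℕ → α → α → Prop)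
    (h0 : ∃ a, Q 0 a) (hs : ∀ n a, Q n a → ∃ b, Q (n + 1) b ∧ R n a b) :
    ∃ f : ℕ → α, (∀ n, Q n (f n)) ∧ ∀ n, R n (f n) (f (n + 1)) := by
  choose a0 ha0 using h0
  choose! g hg using hs
  let f : ℕ → α := fun n => Nat.rec a0 (fun n a => g n a) n
  have hf : ∀ n, Q n (f n) := fun n => by
    induction n with
    | zero => exact ha0
    | succ n ih => exact (hg n (f n) ih).1
  exact ⟨f, hf, fun n => (hg n (f n) (hf n)).2⟩

/-- The nearest root gives the smallest factor. This turns a small value of a polynomial into a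
nearby root. -/
theorem exists_pow_card_le_prod {s : Multiset k} (hs : s ≠ 0) (z : k) :
    ∃ β ∈ s, ‖z - β‖ ^ s.card ≤ (s.map (‖z - ·‖)).prod := by
  classical
  obtain ⟨β, hβ, hmin⟩ := s.toFinset.exists_min_image (fun β => ‖z - β‖)
    (by simpa using hs)
  refine ⟨β, Multiset.mem_toFinset.1 hβ, ?_⟩
  have h := Multiset.prod_map_le_prod_map₀ (s := s) (fun _ => ‖z - β‖) (fun γ => ‖z - γ‖)
    (fun _ _ => norm_nonneg _) (fun γ hγ => hmin γ (Multiset.mem_toFinset.2 hγ))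
  simpa using h

/-- All the remaining factors are at most 1, by the ultrametric inequality. -/
theorem prod_norm_sub_le {s : Multiset k} (hs : ∀ β ∈ s, ‖β‖ = 1) {z α : k} (hz : ‖z‖ = 1)
    (hα : α ∈ s) : (s.map (‖z - ·‖)).prod ≤ ‖z - α‖ := by
  obtain ⟨t, rfl⟩ := Multiset.exists_cons_of_mem hα
  rw [Multiset.map_cons, Multiset.prod_cons]
  refine mul_le_of_le_one_right (norm_nonneg _) ?_
  have h := Multiset.prod_map_le_prod_map₀ (s := t) (fun γ => ‖z - γ‖) (fun _ => (1 : ℝ))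
    (fun _ _ => norm_nonneg _) (fun γ hγ => (norm_sub_le_max_of_ultrametric z γ).trans
      (by rw [hz, hs γ (Multiset.mem_cons_of_mem hγ), max_self]))
  simpa using h

/-- A two-sided series, convergent on the unit circle, whose maximal coefficient norm is attained at
two different indices has a zero of norm one. -/
theorem HasExtremes.exists_zero [CompleteSpace k] [IsAlgClosed k] {b : ℤ → k} {l u : ℤ} {M : ℝ}
    (h : HasExtremes b l u M) (hlu : l < u) (hb : Tendsto b cofinite (𝓝 0)) :
    ∃ z : k, ‖z‖ = 1 ∧ HasSum (fun i => b i * z ^ i) 0 := by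
  -- From here on both extremal indices lie in the truncation range, so every truncation has the
  -- same number d = u - l of roots of norm one.
  set N₀ : ℕ := max l.natAbs u.natAbs with hN₀
  have hext : ∀ n : ℕ, HasExtremes (intCoeff (_root_.truncPoly b (N₀ + n))) (l + (N₀ + n : ℕ))
      (u + (N₀ + n : ℕ)) M := fun n => h.truncPoly (by omega) (by omega)
  choose s hs_card hs_root hs_eval using fun n => exists_unit_roots (hext n)
  set d : ℕ := (u - l).toNat with hd
  have hcard : ∀ n, (s n).card = d := fun n => by have := hs_card n; omega
  have hd0 : d ≠ 0 := by omega
  have hsne : ∀ n, s n ≠ 0 := fun n h0 => by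
    have := hcard n
    rw [h0, Multiset.card_zero] at this
    exact hd0 this.symm
  set ε : ℕ → ℝ := fun n => max ‖b (-(N₀ + n + 1 : ℕ))‖ ‖b (N₀ + n + 1 : ℕ)‖ with hε
  have hε0 : Tendsto ε atTop (𝓝 0) := by
    have hb' := tendsto_zero_iff_norm_tendsto_zero.1 hb
    have i1 : Function.Injective fun n : ℕ => -((N₀ + n + 1 : ℕ) : ℤ) := fun m n hmn => by
      simp only at hmn; omega
    have i2 : Function.Injective fun n : ℕ => ((N₀ + n + 1 : ℕ) : ℤ) := fun m n hmn => by
      simp only at hmn; omega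
    have t1 := hb'.comp i1.tendsto_cofinite
    have t2 := hb'.comp i2.tendsto_cofinite
    rw [Nat.cofinite_eq_atTop] at t1 t2
    have t := t1.max t2
    rw [max_self] at t
    exact t
  -- Each chosen root is followed by a nearest unit root of the next truncation; its distance to the
  -- power d is controlled by the two new coefficients, hence tends to zero.
  obtain ⟨α, hα, hstep⟩ := exists_seq_of_forall_step (fun n a => a ∈ s n)
    (fun n a a' => M * ‖a' - a‖ ^ d ≤ ε n) (Multiset.exists_mem_of_ne_zero (hsne 0))
    (fun n a ha => by
      obtain ⟨β, hβ, hle⟩ := exists_pow_card_le_prod (hsne (n + 1)) a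
      refine ⟨β, hβ, ?_⟩
      obtain ⟨ha1, ha0⟩ := hs_root n a ha
      have h1 := hs_eval (n + 1) a ha1
      have h2 := eval_truncPoly_succ b (N₀ + n) a
      rw [ha0, mul_zero, zero_add] at h2
      rw [hcard] at hle
      rw [norm_sub_rev]
      calc M * ‖a - β‖ ^ d ≤ M * ((s (n + 1)).map (‖a - ·‖)).prod :=
            mul_le_mul_of_nonneg_left hle h.pos.le
        _ = ‖(_root_.truncPoly b (N₀ + n + 1)).eval a‖ := h1.symm
        _ ≤ ε n := by
          rw [h2]
          refine (IsUltrametricDist.norm_add_le_max _ _).trans ?_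
          rw [norm_mul, norm_pow, ha1, one_pow, mul_one])
  have hdiff : Tendsto (fun n => α (n + 1) - α n) atTop (𝓝 0) := by
    rw [Metric.tendsto_nhds]
    intro δ hδ
    filter_upwards [hε0.eventually_lt_const (mul_pos h.pos (pow_pos hδ d))] with n hn
    rw [dist_zero_right]
    refine lt_of_pow_lt_pow_left₀ d hδ.le ?_
    exact lt_of_mul_lt_mul_left ((hstep n).trans_lt hn) h.pos.le
  obtain ⟨z, hz⟩ := cauchySeq_tendsto_of_complete
    (NonarchimedeanAddGroup.cauchySeq_of_tendsto_sub_nhds_zero hdiff)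
  have hz1 : ‖z‖ = 1 := tendsto_nhds_unique hz.norm
    (tendsto_const_nhds.congr fun n => (hs_root n _ (hα n)).1.symm)
  have hz0 : z ≠ 0 := norm_ne_zero_iff.1 (by rw [hz1]; exact one_ne_zero)
  refine ⟨z, hz1, ?_⟩
  have hsum : Summable fun i => b i * z ^ i := by
    refine NonarchimedeanAddGroup.summable_of_tendsto_cofinite_zero ?_
    rw [tendsto_zero_iff_norm_tendsto_zero] at hb ⊢
    refine hb.congr fun i => ?_
    rw [norm_mul, norm_zpow, hz1, one_zpow, mul_one]
  have htend : Tendsto (fun n : ℕ => ∑ i ∈ Finset.Icc (-((N₀ + n : ℕ) : ℤ)) (N₀ + n : ℕ),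
      b i * z ^ i) atTop (𝓝 (∑' i, b i * z ^ i)) := by
    have t1 : Tendsto (fun n : ℕ => N₀ + n) atTop atTop :=
      tendsto_atTop_mono (fun n => Nat.le_add_left n N₀) tendsto_id
    exact (hsum.hasSum.comp Finset.tendsto_Icc_neg).comp t1
  -- At the limit z the truncation has norm M times the product of the distances to its unit roots,
  -- hence at most M |z - α n|.
  have htend0 : Tendsto (fun n : ℕ => ∑ i ∈ Finset.Icc (-((N₀ + n : ℕ) : ℤ)) (N₀ + n : ℕ),
      b i * z ^ i) atTop (𝓝 0) := by
    have hdist : Tendsto (fun n => M * ‖z - α n‖) atTop (𝓝 0) := by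
      simpa using ((tendsto_const_nhds (x := z)).sub hz).norm.const_mul M
    refine squeeze_zero_norm (fun n => ?_) hdist
    have h1 := hs_eval n z hz1
    rw [eval_truncPoly_eq_sum_Icc b _ hz0, norm_mul, norm_pow, hz1, one_pow, one_mul] at h1
    rw [h1]
    exact mul_le_mul_of_nonneg_left
      (prod_norm_sub_le (fun β hβ => (hs_root n β hβ).1) hz1 (hα n)) h.pos.le
  rw [← tendsto_nhds_unique htend htend0]
  exact hsum.hasSum

end Roots

/-! ### Functions without zeros. -/

namespace AnalyticFunction

variable {k : Type*} [NormedField k] {I : RadiusInterval} [IsUltrametricDist k] [CompleteSpace k]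

theorem exists_hasExtremes {b : ℤ → k} (hb : Tendsto b cofinite (𝓝 0)) {i : ℤ} (hi : b i ≠ 0)
    (hmax : ∀ n, ‖b n‖ ≤ ‖b i‖) {j : ℤ} (hij : i ≠ j) (hj : ‖b j‖ = ‖b i‖) :
    ∃ l u, l < u ∧ HasExtremes b l u ‖b i‖ := by
  have hpos := norm_pos_iff.2 hi
  have hfin : {n : ℤ | ¬ ‖b n‖ < ‖b i‖}.Finite := eventually_cofinite.1
    ((tendsto_zero_iff_norm_tendsto_zero.1 hb).eventually_lt_const hpos)
  have hmem : ∀ n, n ∈ hfin.toFinset ↔ ¬ ‖b n‖ < ‖b i‖ := fun n => by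
    rw [Set.Finite.mem_toFinset]; rfl
  have hiF : i ∈ hfin.toFinset := (hmem i).2 (lt_irrefl _)
  have hjF : j ∈ hfin.toFinset := (hmem j).2 (by rw [hj]; exact lt_irrefl _)
  have hne : hfin.toFinset.Nonempty := ⟨i, hiF⟩
  have heq : ∀ n ∈ hfin.toFinset, ‖b n‖ = ‖b i‖ := fun n hn =>
    le_antisymm (hmax n) (not_lt.1 ((hmem n).1 hn))
  refine ⟨hfin.toFinset.min' hne, hfin.toFinset.max' hne, ?_, hpos, hmax,
    heq _ (Finset.min'_mem _ _), heq _ (Finset.max'_mem _ _), fun n hn => ?_, fun n hn => ?_⟩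
  · exact Finset.min'_lt_max' _ hiF hjF hij
  · by_contra hcon
    exact absurd (Finset.min'_le _ n ((hmem n).2 hcon)) (not_le.2 hn)
  · by_contra hcon
    exact absurd (Finset.le_max' _ n ((hmem n).2 hcon)) (not_le.2 hn)

theorem exists_max_coeff {f : AnalyticFunction k I} (hf : f ≠ 0) {ρ : ℝ} (hρ : ρ ∈ I) :
    ∃ i, f.coeff i ≠ 0 ∧ ∀ n, ‖f.coeff n‖ * ρ ^ n ≤ ‖f.coeff i‖ * ρ ^ i := by
  have hpos := I.pos ρ hρ
  obtain ⟨j, hj⟩ : ∃ j, f.coeff j ≠ 0 := by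
    by_contra hcon
    push Not at hcon
    exact hf (ext hcon)
  have hj' : 0 < ‖f.coeff j‖ * ρ ^ j := mul_pos (norm_pos_iff.2 hj) (zpow_pos hpos j)
  have hfin : {n : ℤ | ¬ ‖f.coeff n‖ * ρ ^ n < ‖f.coeff j‖ * ρ ^ j}.Finite :=
    eventually_cofinite.1 ((f.tendsto_coeff hρ).eventually_lt_const hj')
  have hmem : ∀ n, n ∈ hfin.toFinset ↔ ¬ ‖f.coeff n‖ * ρ ^ n < ‖f.coeff j‖ * ρ ^ j := fun n => by
    rw [Set.Finite.mem_toFinset]; rfl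
  obtain ⟨i, hi, hmax⟩ := hfin.toFinset.exists_max_image (fun n => ‖f.coeff n‖ * ρ ^ n)
    ⟨j, (hmem j).2 (lt_irrefl _)⟩
  have hji : ‖f.coeff j‖ * ρ ^ j ≤ ‖f.coeff i‖ * ρ ^ i := not_lt.1 ((hmem i).1 hi)
  refine ⟨i, fun h0 => ?_, fun n => ?_⟩
  · rw [h0, norm_zero, zero_mul] at hji
    exact absurd hji (not_le.2 hj')
  · by_cases hn : ‖f.coeff n‖ * ρ ^ n < ‖f.coeff j‖ * ρ ^ j
    · exact hn.le.trans hji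
    · exact hmax n ((hmem n).2 hn)

variable [IsAlgClosed k]

/-- If the Gauss norm at some radius is attained at two indices, then the function has a zero. -/
theorem exists_absAt_eq_zero {f : AnalyticFunction k I} {ρ : ℝ} (hρ : ρ ∈ I) {i j : ℤ}
    (hij : i ≠ j) (hi : f.coeff i ≠ 0) (hmax : ∀ n, ‖f.coeff n‖ * ρ ^ n ≤ ‖f.coeff i‖ * ρ ^ i)
    (hj : ‖f.coeff j‖ * ρ ^ j = ‖f.coeff i‖ * ρ ^ i) :
    ∃ x : BerkovichAnnulus k I, absAt x f = 0 := by
  have hpos := I.pos ρ hρ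
  have hipos : 0 < ‖f.coeff i‖ * ρ ^ i := mul_pos (norm_pos_iff.2 hi) (zpow_pos hpos i)
  have hj0 : f.coeff j ≠ 0 := fun h0 => by
    rw [h0, norm_zero, zero_mul] at hj
    exact hipos.ne hj
  -- A tie between two terms makes a positive power of ρ the norm of a quotient of coefficients, and
  -- a root of that quotient has norm ρ.
  obtain ⟨α, hα⟩ : ∃ α : k, ‖α‖ = ρ := by
    obtain ⟨m, hm, c, hc⟩ : ∃ m : ℕ, m ≠ 0 ∧ ∃ c : k, ‖c‖ = ρ ^ m := by
      have key : ∀ i j : ℤ, i < j → f.coeff i ≠ 0 → f.coeff j ≠ 0 →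
          ‖f.coeff j‖ * ρ ^ j = ‖f.coeff i‖ * ρ ^ i → ∃ m : ℕ, m ≠ 0 ∧ ∃ c : k, ‖c‖ = ρ ^ m := by
        intro i j hij _ hj0 hj
        refine ⟨(j - i).toNat, by omega, f.coeff i / f.coeff j, ?_⟩
        have e : ρ ^ (j - i).toNat = ρ ^ j / ρ ^ i := by
          rw [← zpow_natCast, Int.toNat_of_nonneg (by omega), zpow_sub₀ hpos.ne']
        rw [e, norm_div, div_eq_div_iff (norm_ne_zero_iff.2 hj0) (zpow_pos hpos i).ne']
        linarith
      rcases lt_or_gt_of_ne hij with h | h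
      · exact key i j h hi hj0 hj
      · exact key j i h hj0 hi hj.symm
    obtain ⟨α, hα⟩ := IsAlgClosed.exists_pow_nat_eq c (Nat.pos_of_ne_zero hm)
    refine ⟨α, (pow_left_inj₀ (norm_nonneg _) hpos.le hm).1 ?_⟩
    rw [← norm_pow, hα, hc]
  have hα0 : α ≠ 0 := norm_ne_zero_iff.1 (by rw [hα]; exact hpos.ne')
  -- Rescaling by α carries the circle of radius ρ to the unit circle.
  set b : ℤ → k := fun n => f.coeff n * α ^ n with hb
  have hnorm : ∀ n, ‖b n‖ = ‖f.coeff n‖ * ρ ^ n := fun n => by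
    rw [hb, norm_mul, norm_zpow, hα]
  have hb0 : Tendsto b cofinite (𝓝 0) := by
    rw [tendsto_zero_iff_norm_tendsto_zero]
    exact (f.tendsto_coeff hρ).congr fun n => (hnorm n).symm
  obtain ⟨l, u, hlu, hext⟩ := exists_hasExtremes hb0 (i := i) (mul_ne_zero hi (zpow_ne_zero _ hα0))
    (fun n => by rw [hnorm, hnorm]; exact hmax n) hij (by rw [hnorm, hnorm]; exact hj)
  obtain ⟨z, hz, hsum⟩ := hext.exists_zero hlu hb0
  have hz0 : z ≠ 0 := norm_ne_zero_iff.1 (by rw [hz]; exact one_ne_zero)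
  have hx : ‖((Units.mk0 (α * z) (mul_ne_zero hα0 hz0) : kˣ) : k)‖ ∈ I := by
    rw [Units.val_mk0, norm_mul, hα, hz, mul_one]
    exact hρ
  refine ⟨rationalPoint _ hx, ?_⟩
  rw [absAt_rationalPoint, norm_eq_zero]
  refine (hasSum_evalAt _ hx f).unique ?_
  refine (congrArg (fun F => HasSum F (0 : k)) (funext fun n => ?_)).mp hsum
  rw [Units.val_mk0, mul_zpow, hb, mul_assoc]

/-- A function without zeros has a dominant term, the same one at all radii. -/
theorem exists_dominant {f : AnalyticFunction k I} (hf : f ≠ 0)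
    (h : ∀ x : BerkovichAnnulus k I, absAt x f ≠ 0) :
    ∃ m, ∀ ρ ∈ I, ∀ i ≠ m, ‖f.coeff i‖ * ρ ^ i < ‖f.coeff m‖ * ρ ^ m := by
  have hdom : ∀ ρ, ρ ∈ I → ∃ m, ∀ i ≠ m, ‖f.coeff i‖ * ρ ^ i < ‖f.coeff m‖ * ρ ^ m := by
    intro ρ hρ
    obtain ⟨m, hm, hmax⟩ := exists_max_coeff hf hρ
    refine ⟨m, fun i hi => lt_of_le_of_ne (hmax i) fun heq => ?_⟩
    obtain ⟨x, hx⟩ := exists_absAt_eq_zero hρ hi.symm hm hmax heq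
    exact h x hx
  choose! m hm using hdom
  have huniq : ∀ ρ ∈ I, ∀ n, (∀ i ≠ n, ‖f.coeff i‖ * ρ ^ i < ‖f.coeff n‖ * ρ ^ n) → m ρ = n := by
    intro ρ hρ n hn
    by_contra hne
    exact lt_asymm (hn _ hne) (hm ρ hρ n (Ne.symm hne))
  have hconst : ∀ a ∈ I, ∀ b ∈ I, a ≤ b → m a = m b := by
    intro a ha b hb hab
    have hsub : ∀ σ ∈ Set.Icc a b, σ ∈ I := fun σ hσ => I.mem_of_mem_Icc ha hb hσ
    -- The dominant index is locally constant; as a continuous map from a connected interval to the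
    -- discrete integers it is then constant.
    have hcont : ContinuousOn m (Set.Icc a b) := by
      intro ρ hρI
      have hρ := hsub ρ hρI
      have hpos := I.pos ρ hρ
      rw [ContinuousWithinAt, nhds_discrete, tendsto_pure]
      set n := m ρ with hn
      have hn0 : 0 < ‖f.coeff n‖ * ρ ^ n :=
        (mul_nonneg (norm_nonneg _) (zpow_nonneg hpos.le _)).trans_lt (hm ρ hρ (n + 1) (by omega))
      set δ := ‖f.coeff n‖ * ρ ^ n / 2 with hδ
      have hδ0 : 0 < δ := half_pos hn0
      have hca : ∀ i : ℤ, ContinuousAt (fun σ : ℝ => ‖f.coeff i‖ * σ ^ i) ρ := fun i =>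
        continuousAt_const.mul (continuousAt_zpow₀ ρ i (Or.inl hpos.ne'))
      -- On [a, b] each term is bounded by its value at b for i ≥ 0 and at a for i ≤ 0. So all but
      -- finitely many terms stay below δ throughout, and continuity handles the rest.
      have hfin : {i : ℤ | ¬ (‖f.coeff i‖ * a ^ i < δ ∧ ‖f.coeff i‖ * b ^ i < δ)}.Finite :=
        eventually_cofinite.1 (((f.tendsto_coeff ha).eventually_lt_const hδ0).and
          ((f.tendsto_coeff hb).eventually_lt_const hδ0))
      have e1 : ∀ᶠ σ in 𝓝 ρ, δ < ‖f.coeff n‖ * σ ^ n :=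
        (hca n).eventually_const_lt (half_lt_self hn0)
      have e2 : ∀ᶠ σ in 𝓝 ρ, ∀ i ∈ hfin.toFinset, i ≠ n →
          ‖f.coeff i‖ * σ ^ i < ‖f.coeff n‖ * σ ^ n := by
        rw [Filter.eventually_all_finset]
        intro i _
        by_cases hi : i = n
        · exact Eventually.of_forall fun σ hne => absurd hi hne
        · filter_upwards [(hca i).eventually_lt (hca n) (hm ρ hρ i hi)] with σ hσ _ using hσ
      filter_upwards [nhdsWithin_le_nhds e1, nhdsWithin_le_nhds e2, self_mem_nhdsWithin]
        with σ h1 h2 hσ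
      refine huniq σ (hsub σ hσ) n fun i hi => ?_
      by_cases hiF : i ∈ hfin.toFinset
      · exact h2 i hiF hi
      · have hiF' : ‖f.coeff i‖ * a ^ i < δ ∧ ‖f.coeff i‖ * b ^ i < δ := by
          simpa only [Set.Finite.mem_toFinset, Set.mem_ofPred_eq, not_not] using hiF
        refine lt_trans ?_ h1
        have hσ0 := I.pos σ (hsub σ hσ)
        rcases le_total 0 i with h0 | h0
        · refine lt_of_le_of_lt (mul_le_mul_of_nonneg_left ?_ (norm_nonneg _)) hiF'.2
          exact zpow_le_zpow_left₀ h0 hσ0.le hσ.2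
        · refine lt_of_le_of_lt (mul_le_mul_of_nonneg_left ?_ (norm_nonneg _)) hiF'.1
          obtain ⟨p, rfl⟩ : ∃ p : ℤ, i = -p := ⟨-i, by omega⟩
          rw [zpow_neg, zpow_neg]
          exact inv_anti₀ (zpow_pos (I.pos a ha) p)
            (zpow_le_zpow_left₀ (by omega) (I.pos a ha).le hσ.1)
    exact isPreconnected_Icc.constant hcont (Set.left_mem_Icc.2 hab) (Set.right_mem_Icc.2 hab)
  obtain ⟨ρ₀, hρ₀⟩ := I.exists_mem
  refine ⟨m ρ₀, fun ρ hρ => ?_⟩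
  have : m ρ₀ = m ρ := by
    rcases le_total ρ₀ ρ with h' | h'
    · exact hconst _ hρ₀ _ hρ h'
    · exact (hconst _ hρ _ hρ₀ h').symm
  rw [this]
  exact hm ρ hρ

/-- A function without zeros is a monomial times a function close to one. -/
theorem exists_eq_monomial_mul {f : AnalyticFunction k I} (hf : f ≠ 0)
    (h : ∀ x : BerkovichAnnulus k I, absAt x f ≠ 0) :
    ∃ (m : ℤ) (c : k) (w : AnalyticFunction k I), c ≠ 0 ∧ IsSmall (w - 1) ∧
      f = monomial m c * w := by
  obtain ⟨m, hm⟩ := exists_dominant hf h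
  have hc : f.coeff m ≠ 0 := by
    obtain ⟨ρ, hρ⟩ := I.exists_mem
    have h1 := (mul_nonneg (norm_nonneg _) (zpow_nonneg (I.pos ρ hρ).le _)).trans_lt
      (hm ρ hρ (m + 1) (by omega))
    intro h0
    rw [h0, norm_zero, zero_mul] at h1
    exact lt_irrefl _ h1
  refine ⟨m, f.coeff m, monomial (-m) (f.coeff m)⁻¹ * f, hc, fun ρ hρ => ?_, ?_⟩
  · have hpos := I.pos ρ hρ
    refine gaussNorm_lt hρ one_pos fun i => ?_
    rw [coeff_sub, coeff_monomial_mul, one_def, coeff_monomial]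
    by_cases hi : i = 0
    · simp [hi, hc]
    · rw [if_neg hi, sub_zero, sub_neg_eq_add, norm_mul, norm_inv]
      have h1 := hm ρ hρ (i + m) (by omega)
      rw [zpow_add₀ hpos.ne', ← mul_assoc] at h1
      have h2 := lt_of_mul_lt_mul_right h1 (zpow_pos hpos m).le
      rw [mul_assoc, inv_mul_lt_one₀ (norm_pos_iff.2 hc)]
      exact h2
  · rw [← mul_assoc, monomial_mul_monomial, add_neg_cancel, mul_inv_cancel₀ hc, ← one_def, one_mul]

end AnalyticFunction

/-! ### The differential equation for the coordinate, and reduction of differentials to functions.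
-/

namespace AnalyticFunction

variable {k : Type*} [NormedField k] {I : RadiusInterval} [IsUltrametricDist k] [CompleteSpace k]

/-- The function with coefficients `μᵢ aᵢ`, for a sequence of multipliers bounded by one. -/
def coeffMul (μ : ℤ → k) (hμ : ∀ i, ‖μ i‖ ≤ 1) (f : AnalyticFunction k I) : AnalyticFunction k I :=
  ⟨fun i => μ i * f.coeff i, fun ρ hρ => by
    refine squeeze_zero (fun i => mul_nonneg (norm_nonneg _) (zpow_nonneg (I.pos ρ hρ).le _))
      (fun i => ?_) (f.tendsto_coeff hρ)
    rw [norm_mul]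
    exact mul_le_mul_of_nonneg_right (mul_le_of_le_one_left (norm_nonneg _) (hμ i))
      (zpow_nonneg (I.pos ρ hρ).le _)⟩

theorem coeff_coeffMul (μ : ℤ → k) (hμ : ∀ i, ‖μ i‖ ≤ 1) (f : AnalyticFunction k I) (i : ℤ) :
    (coeffMul μ hμ f).coeff i = μ i * f.coeff i := rfl

theorem IsSmall.coeffMul {f : AnalyticFunction k I} (hf : IsSmall f) {μ : ℤ → k}
    (hμ : ∀ i, ‖μ i‖ ≤ 1) : IsSmall (coeffMul μ hμ f) := by
  intro ρ hρ
  refine (gaussNorm_le fun i => ?_).trans_lt (hf ρ hρ)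
  rw [coeff_coeffMul, norm_mul]
  exact (mul_le_mul_of_nonneg_right (mul_le_of_le_one_left (norm_nonneg _) (hμ i))
      (zpow_nonneg (I.pos ρ hρ).le _)).trans (norm_coeff_mul_le_gaussNorm f hρ i)

theorem coeff_sub_one (v : AnalyticFunction k I) {i : ℤ} (hi : i ≠ 0) :
    (v - 1).coeff i = v.coeff i := by
  rw [coeff_sub, one_def, coeff_monomial, if_neg hi, sub_zero]

theorem coeff_sub_one_zero (v : AnalyticFunction k I) : (v - 1).coeff 0 = v.coeff 0 - 1 := by
  rw [coeff_sub, one_def, coeff_monomial, if_pos rfl]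

theorem coeff_one (i : ℤ) : (1 : AnalyticFunction k I).coeff i = if i = 0 then 1 else 0 := by
  rw [one_def, coeff_monomial]

theorem norm_coeff_zero_eq_one {v : AnalyticFunction k I} (hv : IsSmall (v - 1)) :
    ‖v.coeff 0‖ = 1 := by
  obtain ⟨ρ, hρ⟩ := I.exists_mem
  have h := (norm_coeff_mul_le_gaussNorm (v - 1) hρ 0).trans_lt (hv ρ hρ)
  rw [coeff_sub_one_zero, zpow_zero, mul_one] at h
  have h1 : ‖(1 : k) - (1 - v.coeff 0)‖ = ‖(1 : k)‖ :=
    norm_sub_eq_left_of_norm_lt (by rw [norm_sub_rev, norm_one]; exact h)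
  rwa [sub_sub_cancel, norm_one] at h1

theorem isSmall_monomial_coeff {v : AnalyticFunction k I} (hv : IsSmall (v - 1)) {n : ℤ}
    (hn : n ≠ 0) : IsSmall (monomial n (v.coeff n) : AnalyticFunction k I) := by
  intro ρ hρ
  refine (gaussNorm_monomial_le _ _ hρ).trans_lt ?_
  rw [← coeff_sub_one v hn]
  exact (norm_coeff_mul_le_gaussNorm _ hρ n).trans_lt (hv ρ hρ)

theorem monomial_pow (n : ℤ) (c : k) (j : ℕ) :
    (monomial n c : AnalyticFunction k I) ^ j = monomial (j * n) (c ^ j) := by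
  induction j with
  | zero => simp [one_def]
  | succ j ih =>
    rw [pow_succ, ih, monomial_mul_monomial, pow_succ]
    congr 1
    push_cast
    ring

theorem euler_monomial (n : ℤ) (c : k) :
    euler (monomial n c : AnalyticFunction k I) = (n : k) • monomial n c := by
  ext i
  rw [coeff_euler, coeff_smul, coeff_monomial]
  split_ifs with h
  · rw [h]
  · simp

section ResidueCharacteristicZero

variable [CharZero (IsLocalRing.ResidueField (NormedField.valuation (K := k)).valuationSubring)]

/-- The Euler derivation reaches every coefficient but the one of index 0, which becomes the scalar;
the division by i costs nothing in norm. -/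
theorem exists_smul_one_add_euler_eq {v : AnalyticFunction k I} (hv : IsSmall (v - 1)) :
    ∃ s, IsSmall s ∧ v.coeff 0 • (1 + euler s) = v := by
  have := charZero_of_charZero_residueField k
  have h0 := norm_coeff_zero_eq_one hv
  have h0' : v.coeff 0 ≠ 0 := norm_ne_zero_iff.1 (by rw [h0]; exact one_ne_zero)
  have hμ : ∀ i : ℤ, ‖(if i = 0 then 0 else (v.coeff 0 * (i : k))⁻¹ : k)‖ ≤ 1 := fun i => by
    split_ifs with hi
    · simp
    · rw [norm_inv, norm_mul, h0, norm_intCast_eq_one_of_charZero_residueField hi]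
      simp
  refine ⟨coeffMul _ hμ (v - 1), hv.coeffMul hμ, ext fun i => ?_⟩
  rw [coeff_smul, coeff_add, coeff_euler, coeff_coeffMul, coeff_one]
  by_cases hi : i = 0
  · simp [hi]
  · have hi' : (i : k) ≠ 0 := Int.cast_ne_zero.2 hi
    rw [if_neg hi, if_neg hi, coeff_sub_one v hi]
    field_simp
    ring

/-- The hypotheses say that a T^e is formally constant and that e(v - a) T^e has primitive G T^e.
Differentiating exp(es) + (e a) s = G therefore returns e times the desired equation. -/
theorem exists_expo_add_mul_one_add_euler_eq {e : k} (he : ‖e‖ = 1) {a G v : AnalyticFunction k I}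
    (ha : IsSmall a) (hG : IsSmall (G - 1)) (hea : euler a = -(e • a))
    (heG : euler G + e • G = e • (v - a)) :
    ∃ s, IsSmall s ∧ (expo (e • s) + a) * (1 + euler s) = v := by
  have he0 : e ≠ 0 := by rintro rfl; simp at he
  obtain ⟨s, hs, h⟩ := exists_expo_add_mul_eq he (ha.smul he.le) hG
  refine ⟨s, hs, ?_⟩
  have h1 := congrArg euler h
  rw [euler_add, euler_mul, euler_expo (hs.smul he.le), euler_smul, euler_smul, hea] at h1
  have h2 : e • ((expo (e • s) + a) * (1 + euler s)) = e • v := by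
    rw [← h1, ← h] at heG
    simp only [Algebra.smul_def] at heG ⊢
    linear_combination heG
  have h3 := congrArg (fun f => e⁻¹ • f) h2
  simpa only [smul_smul, inv_mul_cancel₀ he0, one_smul] using h3

/-- The differential equation for a coordinate `T exp s`, where `e` is the exponent `m / q`. -/
theorem exists_solution {q : ℕ} (hq : 0 < q) {m : ℤ} (hm : m ≠ 0) {v : AnalyticFunction k I}
    (hv : IsSmall (v - 1)) {a : AnalyticFunction k I} (ha : IsSmall a)
    (hcoeff : ∀ i : ℤ, a.coeff i = if q * i + m = 0 then v.coeff i else 0) :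
    ∃ s, IsSmall s ∧ (expo (((m : k) / (q : k)) • s) + a) * (1 + euler s) = v := by
  have := charZero_of_charZero_residueField k
  set e : k := (m : k) / (q : k) with he_def
  have hqn : ‖(q : k)‖ = 1 := norm_natCast_eq_one_of_charZero_residueField hq.ne'
  have hq0 : (q : k) ≠ 0 := Nat.cast_ne_zero.2 hq.ne'
  have he : ‖e‖ = 1 := by
    rw [he_def, norm_div, norm_intCast_eq_one_of_charZero_residueField hm, hqn, div_one]
  have hadd : ∀ i : ℤ, (i : k) + e = ((q * i + m : ℤ) : k) / q := fun i => by
    rw [he_def]; push_cast; field_simp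
  have hadd0 : ∀ i : ℤ, q * i + m = 0 → (i : k) + e = 0 := fun i hi => by
    rw [hadd, hi]; simp
  have hadd1 : ∀ i : ℤ, q * i + m ≠ 0 → ‖(i : k) + e‖ = 1 := fun i hi => by
    rw [hadd, norm_div, norm_intCast_eq_one_of_charZero_residueField hi, hqn, div_one]
  -- These multipliers invert θ + e, up to the factor e, away from the resonant index. There the
  -- value 0 is harmless, since both θ + e and v - a vanish at that coefficient.
  have hμ : ∀ i : ℤ, ‖(if q * i + m = 0 then 0 else e / ((i : k) + e) : k)‖ ≤ 1 := fun i => by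
    split_ifs with hi
    · simp
    · rw [norm_div, he, hadd1 i hi, div_one]
  -- At index 0 the multiplier is e / e = 1, so splitting off the constant 1 is consistent and G - 1
  -- inherits smallness from v - 1.
  refine exists_expo_add_mul_one_add_euler_eq he (G := 1 + coeffMul _ hμ (v - 1)) ha ?_ ?_ ?_
  · rw [add_sub_cancel_left]
    exact hv.coeffMul hμ
  · refine ext fun i => ?_
    rw [coeff_euler, coeff_neg, coeff_smul, hcoeff]
    split_ifs with hi
    · linear_combination v.coeff i * hadd0 i hi
    · simp
  · refine ext fun i => ?_
    rw [coeff_add, coeff_euler, coeff_smul, coeff_smul, coeff_add, coeff_coeffMul,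
      coeff_sub v a, hcoeff, ← add_mul]
    by_cases hi0 : i = 0
    · subst hi0
      have he0 : e ≠ 0 := by rintro h; simp [h] at he
      rw [coeff_sub_one_zero, coeff_one]
      simp [hm, he0]
    · rw [coeff_sub_one v hi0, coeff_one, if_neg hi0]
      split_ifs with hi
      · simp
      · have h1 : (i : k) + e ≠ 0 := norm_ne_zero_iff.1 (by rw [hadd1 i hi]; exact one_ne_zero)
        field_simp
        ring

/-- Roots of functions close to one. -/
theorem exists_pow_eq {q : ℕ} (hq : 0 < q) {w : AnalyticFunction k I} (hw : IsSmall (w - 1)) :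
    ∃ v : AnalyticFunction k I, IsSmall (v - 1) ∧ v ^ q = w := by
  have := charZero_of_charZero_residueField k
  obtain ⟨s, hs, rfl⟩ := exists_expo_eq hw
  have hq' : ‖(q : k)⁻¹‖ ≤ 1 := by
    rw [norm_inv, norm_natCast_eq_one_of_charZero_residueField hq.ne', inv_one]
  refine ⟨expo ((q : k)⁻¹ • s), isSmall_expo_sub_one (hs.smul hq'), ?_⟩
  rw [expo_pow (hs.smul hq'), smul_smul, mul_inv_cancel₀ (Nat.cast_ne_zero.2 hq.ne'), one_smul]

/-- Logarithmic differentiation of t = T exp(s): dt/t = (1 + θs) dT/T. -/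
theorem inv_twistUnit_mul_derivative {s : AnalyticFunction k I} (hs : IsSmall s) :
    (((twistUnit s hs)⁻¹ : (AnalyticFunction k I)ˣ) : AnalyticFunction k I) *
      derivative (twistUnit s hs : AnalyticFunction k I) = monomial (-1) 1 * (1 + euler s) := by
  have hT : (monomial (-1) 1 * T : AnalyticFunction k I) = 1 := unitT.inv_val
  have h1 : euler (twistUnit s hs : AnalyticFunction k I) =
      (twistUnit s hs : AnalyticFunction k I) * (1 + euler s) := by
    show euler (T * expo s) = T * expo s * (1 + euler s)
    rw [euler_mul, euler_expo hs, T, euler_monomial, Int.cast_one, one_smul]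
    ring
  have h2 : derivative (twistUnit s hs : AnalyticFunction k I) =
      monomial (-1) 1 * euler (twistUnit s hs : AnalyticFunction k I) := by
    rw [euler, ← mul_assoc, hT, one_mul]
  rw [h2, h1, mul_left_comm, Units.inv_mul_cancel_left]

end ResidueCharacteristicZero

/-- The `q`-differential `(dT)^q`. -/
def dTPow (q : ℕ) : QDifferential k I q :=
  PiTensorProduct.tprod (AnalyticFunction k I)
    fun _ : Fin q => (show DifferentialForm k I from (1 : AnalyticFunction k I))

theorem tprod_eq_smul_dTPow {q : ℕ} (g : Fin q → AnalyticFunction k I) :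
    (PiTensorProduct.tprod (AnalyticFunction k I)
      fun i : Fin q => (show DifferentialForm k I from g i) : QDifferential k I q) =
      (∏ i, g i) • dTPow q := by
  rw [dTPow, ← MultilinearMap.map_smul_univ]
  congr 1
  funext i
  exact (mul_one (g i)).symm

/-- Only that (dT)^q generates is needed; uniqueness of the coefficient plays no role. -/
theorem exists_eq_smul_dTPow {q : ℕ} (ξ : QDifferential k I q) :
    ∃ f : AnalyticFunction k I, ξ = f • dTPow q := by
  induction ξ using PiTensorProduct.induction_on with
  | smul_tprod r g =>
    have h := tprod_eq_smul_dTPow fun i => (show AnalyticFunction k I from g i)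
    exact ⟨r * ∏ i, (show AnalyticFunction k I from g i), by rw [mul_smul, ← h]⟩
  | add x y hx hy =>
    obtain ⟨f, rfl⟩ := hx
    obtain ⟨g, rfl⟩ := hy
    exact ⟨f + g, (add_smul f g _).symm⟩

theorem hasZeroAt_smul_dTPow {q : ℕ} {f : AnalyticFunction k I} {x : BerkovichAnnulus k I}
    (h : absAt x f = 0) : HasZeroAt (f • dTPow q : QDifferential k I q) x :=
  Submodule.smul_mem_smul (I := vanishingIdeal x) h Submodule.mem_top

theorem dlogPow_twistUnit
    [CharZero (IsLocalRing.ResidueField (NormedField.valuation (K := k)).valuationSubring)]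
    {s : AnalyticFunction k I} (hs : IsSmall s) (q : ℕ) :
    dlogPow q (twistUnit s hs) = (monomial (-1) 1 * (1 + euler s)) ^ q • dTPow q := by
  have h := tprod_eq_smul_dTPow (k := k) (I := I)
    (fun _ : Fin q => monomial (-1) 1 * (1 + euler s))
  rw [Finset.prod_const, Finset.card_univ, Fintype.card_fin] at h
  rw [← h, ← inv_twistUnit_mul_derivative hs]
  rfl

end AnalyticFunction

end

/-! ### The normal forms. -/

open AnalyticFunction

theorem mainTheorem3 {k : Type*} [NormedField k] [IsUltrametricDist k] [CompleteSpace k]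
    [IsAlgClosed k]
    [CharZero (IsLocalRing.ResidueField (NormedField.valuation (K := k)).valuationSubring)]
    (I : RadiusInterval) (q : ℕ) (hq : 0 < q) (ξ : QDifferential k I q)
    (hξ : ∀ x : BerkovichAnnulus k I, ¬ HasZeroAt ξ x) :
    ∃ t : (AnalyticFunction k I)ˣ, IsCoordinate (t : AnalyticFunction k I) ∧
      ((∃ (n : ℤ) (c c₀ : k), n ≠ 0 ∧ (q : ℤ) ∣ n ∧
          (∀ x : BerkovichAnnulus k I,
            absAt x (algebraMap k _ c₀) <
              absAt x (algebraMap k _ c * ((t ^ (n / q) : (AnalyticFunction k I)ˣ) :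
                AnalyticFunction k I))) ∧
          ξ = (algebraMap k _ c * ((t ^ (n / q) : (AnalyticFunction k I)ˣ) :
                AnalyticFunction k I) + algebraMap k _ c₀) ^ q • dlogPow q t) ∨
        (∃ (n : ℤ) (c : k),
          ξ = (algebraMap k _ (c ^ q) * ((t ^ n : (AnalyticFunction k I)ˣ) :
                AnalyticFunction k I)) • dlogPow q t)) := by
  have := charZero_of_charZero_residueField k
  have hqk : (q : k) ≠ 0 := Nat.cast_ne_zero.2 hq.ne'
  obtain ⟨f, rfl⟩ := exists_eq_smul_dTPow ξ
  -- The zero differential has the second form with constant 0; treating it directly avoids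
  -- exhibiting a point of the annulus.
  by_cases hf : f = 0
  · refine ⟨twistUnit 0 isSmall_zero, isCoordinate_twistUnit isSmall_zero, Or.inr ⟨0, 0, ?_⟩⟩
    rw [hf, zero_pow hq.ne', map_zero, zero_mul, zero_smul, zero_smul]
  obtain ⟨m', c', w, hc', hw, rfl⟩ := exists_eq_monomial_mul hf
    fun x hx => hξ x (hasZeroAt_smul_dTPow hx)
  -- The shift by q accounts for (dT)^q = T^q (dT/T)^q: the exponent relative to dT/T is m.
  obtain ⟨m, rfl⟩ : ∃ m : ℤ, m' = m - q := ⟨m' + q, by ring⟩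
  obtain ⟨γ, rfl⟩ := IsAlgClosed.exists_pow_nat_eq c' hq
  have hγ : γ ≠ 0 := fun h => hc' (by rw [h, zero_pow hq.ne'])
  obtain ⟨v, hv, rfl⟩ := exists_pow_eq hq hw
  by_cases hm : m = 0
  · subst hm
    obtain ⟨s, hs, hsv⟩ := exists_smul_one_add_euler_eq hv
    refine ⟨twistUnit s hs, isCoordinate_twistUnit hs, Or.inr ⟨0, γ * v.coeff 0, ?_⟩⟩
    rw [dlogPow_twistUnit, smul_smul, zpow_zero, Units.val_one, mul_one, map_pow, ← mul_pow]
    congr 1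
    nth_rewrite 1 [← hsv]
    have e : (monomial (0 - q) (γ ^ q) : AnalyticFunction k I) = monomial (-1) γ ^ q := by
      rw [monomial_pow]; congr 1; ring
    have e' : (monomial (-1) γ : AnalyticFunction k I) =
        algebraMap k _ γ * monomial (-1) 1 := by
      rw [algebraMap_eq_monomial, monomial_mul_monomial, zero_add, mul_one]
    rw [e, e', ← mul_pow, Algebra.smul_def, map_mul]
    ring
  by_cases hdvd : (q : ℤ) ∣ m
  · obtain ⟨d, rfl⟩ := hdvd
    have hd : d ≠ 0 := by rintro rfl; simp at hm
    have hqz : (q : ℤ) ≠ 0 := by exact_mod_cast hq.ne'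
    -- With m = q d the resonant index is -d, and the correction a is the term of v there.
    obtain ⟨s, hs, hsv⟩ := exists_solution hq hm hv
      (isSmall_monomial_coeff hv (neg_ne_zero.2 hd)) (fun i => by
        rw [coeff_monomial]
        have : (q : ℤ) * i + q * d = 0 ↔ i = -d := by
          rw [← mul_add, mul_eq_zero, or_iff_right hqz, add_eq_zero_iff_eq_neg]
        by_cases hi : i = -d
        · rw [if_pos hi, if_pos (this.2 hi), hi]
        · rw [if_neg hi, if_neg (fun h => hi (this.1 h))])
    have he : (((q * d : ℤ) : k) / (q : k)) = (d : k) := by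
      push_cast; field_simp
    rw [he] at hsv
    have hdiv : (q : ℤ) * d / q = d := Int.mul_ediv_cancel_left d hqz
    have hc₀ : algebraMap k (AnalyticFunction k I) (γ * v.coeff (-d)) =
        monomial d γ * monomial (-d) (v.coeff (-d)) := by
      rw [monomial_mul_monomial, add_neg_cancel, algebraMap_eq_monomial]
    refine ⟨twistUnit s hs, isCoordinate_twistUnit hs,
      Or.inl ⟨q * d, γ, γ * v.coeff (-d), hm, dvd_mul_right _ _, fun x => ?_, ?_⟩⟩
    -- The exponential has absolute value 1 everywhere and c₀ = γ T^d · v₋d T^(-d), so the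
    -- inequality reduces to smallness of the second factor.
    · rw [hdiv, algebraMap_mul_twistUnit_zpow, hc₀, absAt_mul, absAt_mul,
        absAt_expo x (isSmall_intCast_smul hs d), mul_one]
      have hpos : 0 < absAt x (monomial d γ) := by
        refine lt_of_le_of_ne (absAt_nonneg x _) fun h0 => ?_
        have h1 : absAt x (monomial d γ * monomial (-d) γ⁻¹) = 1 := by
          rw [monomial_mul_monomial, add_neg_cancel, mul_inv_cancel₀ hγ, ← one_def, absAt_one]
        rw [absAt_mul, ← h0, zero_mul] at h1
        exact zero_ne_one h1
      exact mul_lt_of_lt_one_right hpos (absAt_lt_of_gaussNorm_lt x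
        (isSmall_monomial_coeff hv (neg_ne_zero.2 hd)))
    · rw [hdiv, algebraMap_mul_twistUnit_zpow, hc₀, dlogPow_twistUnit, smul_smul, ← mul_pow]
      congr 1
      have e : (monomial (q * d - q) (γ ^ q) : AnalyticFunction k I) =
          (monomial d γ * monomial (-1) 1) ^ q := by
        rw [monomial_mul_monomial, monomial_pow, mul_one]; congr 1; ring
      rw [e, ← mul_pow]
      congr 1
      linear_combination -(monomial d γ * monomial (-1) 1 : AnalyticFunction k I) * hsv
  -- Without divisibility no index is resonant, so a = 0.
  · obtain ⟨s, hs, hsv⟩ := exists_solution hq hm hv isSmall_zero (fun i => by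
      rw [if_neg fun h => hdvd ⟨-i, by linarith⟩, coeff_zero])
    rw [add_zero] at hsv
    have he1 : ‖((m : k) / (q : k))‖ ≤ 1 := by
      rw [norm_div, norm_intCast_eq_one_of_charZero_residueField hm,
        norm_natCast_eq_one_of_charZero_residueField hq.ne', div_one]
    -- The function t^(m/q) need not exist, but its exponential factor does, and only its q-th power
    -- enters.
    have hexp : expo ((m : k) • s) = expo (((m : k) / (q : k)) • s) ^ q := by
      rw [expo_pow (hs.smul he1), smul_smul, mul_div_cancel₀ _ hqk]
    refine ⟨twistUnit s hs, isCoordinate_twistUnit hs, Or.inr ⟨m, γ, ?_⟩⟩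
    rw [algebraMap_mul_twistUnit_zpow, dlogPow_twistUnit, smul_smul, hexp]
    congr 1
    have e : (monomial (m - q) (γ ^ q) : AnalyticFunction k I) =
        monomial m (γ ^ q) * monomial (-1) 1 ^ q := by
      rw [monomial_pow, monomial_mul_monomial, one_pow, mul_one]; congr 1; ring
    rw [e]
    nth_rewrite 1 [← hsv]
    rw [mul_pow, mul_pow]
    ring
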